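/- All spaces are compactly generated weak Hausdorff, and spectra are coordinate-free $\Omega$-spectra indexed on the finite-dimensional subspaces of $\mathbb{R}^\infty$; $\Omega^\infty R=R(0)$ is the zeroth space of $R$ and $\pi_0(R)=\pi_0(\Omega^\infty R)$. An $E_\infty$ ring spectrum is an algebra over an $E_\infty$ operad augmented over the linear isometries operad. For an $E_\infty$ ring spectrum $R$, the space of units $GL_1(R)$ is the pullback of $\Omega^\infty R\to\pi_0(R)\leftarrow\pi_0(R)^\times$. Let $G$ be a finite group and let $EG$ be a contractible compactly generated Hausdorff space with a free $G$-action. For a space or spectrum $X$ with $G$-action write $X^{hG}=F(EG_+,X)^G$; if $G$ acts on an $E_\infty$ ring spectrum $R$ by maps of $E_\infty$ ring spectra, then $R^{hG}$ is again an $E_\infty$ ring spectrum. (1) Let $R$ be an $E_\infty$ ring spectrum on which $G$ acts by maps of $E_\infty$ ring spectra, and suppose that the natural map $\pi_0(R^{hG})\to\pi_0(R)^G$ (evaluation at a point of $EG$) is bijective. Then the canonical identification $(\Omega^\infty R)^{hG}=\Omega^\infty(R^{hG})$ restricts to a homeomorphism $GL_1(R)^{hG}\cong GL_1(R^{hG})$.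 (2) (Topological Hilbert 90) Let $A\to B$ be a weak $G$-Galois extension: $A$ is a commutative $\mathbb{S}$-algebra, $B$ is a cofibrant commutative $A$-algebra on which $G$ acts by maps of commutative $A$-algebras, the natural map $A\to B^{hG}$ is a weak equivalence, and the map $B\wedge_A B\to F(G_+,B)=\prod_{\gamma\in G}B$, $b_1\wedge b_2\mapsto(b_1\cdot\gamma b_2)_\gamma$, is a weak equivalence. If the natural map $\pi_0(A)\to\pi_0(B)^G$ is bijective, then the natural map $GL_1(A)\to GL_1(B)^{hG}$ is a weak homotopy equivalence. The same holds if $B$ is ramified over $A$; more generally, it holds for every map $A\to B$ of $E_\infty$ ring spectra with an action of $G$ on $B$ by maps of $E_\infty$ ring spectra under $A$ for which $A\to B^{hG}$ is a weak equivalence and $\pi_0(A)\to\pi_0(B)^G$ is bijective. -/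

import Mathlib

open CategoryTheory Topology

universe u v w

namespace BraveNew

/-! ### Homotopy groups and weak equivalences of spaces -/

/-- The map induced by `f` on sets of path components. -/
def pi0Map {X Y : Type*} [TopologicalSpace X] [TopologicalSpace Y] (f : C(X, Y)) :
    ZerothHomotopy X → ZerothHomotopy Y :=
  ZerothHomotopy.lift (fun x => ZerothHomotopy.mk (f x))
    (fun _ _ p => ZerothHomotopy.sound (p.map f.continuous))

/-- The map induced by `f` on the `n`-th homotopy groups based at `x`. -/
def piMap {X Y : Type*} [TopologicalSpace X] [TopologicalSpace Y] (n : ℕ) (f : C(X, Y)) (x : X) :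
    HomotopyGroup (Fin n) X x → HomotopyGroup (Fin n) Y (f x) :=
  Quotient.map (fun p => ⟨f.comp p.1, fun y hy => congrArg f (p.2 y hy)⟩)
    (fun _ _ ⟨H⟩ => ⟨H.compContinuousMap f⟩)

/-- A weak homotopy equivalence: a bijection on path components and on all homotopy groups at all
base points. -/
structure IsWeakHomotopyEquiv {X Y : Type*} [TopologicalSpace X] [TopologicalSpace Y]
    (f : C(X, Y)) : Prop where
  pi0 : Function.Bijective (pi0Map f)
  pi : ∀ (n : ℕ) (x : X), Function.Bijective (piMap n f x)

/-! ### The universe `ℝ^∞`, its indexing spaces and its linear isometries -/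

/-- The finitely supported sequences inside `ℓ²`. -/
noncomputable def finSupp : Submodule ℝ (lp (fun _ : ℕ => ℝ) 2) :=
  Submodule.span ℝ (Set.range fun i : ℕ => lp.single 2 i (1 : ℝ))

/-- The universe `ℝ^∞ = ⨁_ℕ ℝ`, with its inner product. -/
abbrev Univ : Type := ↥finSupp

/-- Indexing spaces: the finite dimensional subspaces of the universe. -/
abbrev Idx : Type := {V : Submodule ℝ Univ // FiniteDimensional ℝ V}

/-- The zero indexing space. -/
noncomputable def Idx.zero : Idx := ⟨⊥, inferInstance⟩

/-- The orthogonal complement `W - V`. -/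
noncomputable abbrev compl (V W : Idx) : Submodule ℝ Univ := V.1ᗮ ⊓ W.1

/-- The sphere `S^(W - V)`, the one-point compactification of `W - V`, based at `∞`. -/
abbrev Sphere (V W : Idx) : Type := OnePoint ↥(compl V W)

/-- The topology of `ℝ^∞` as the union of its finite dimensional subspaces. -/

noncomputable abbrev finTop : TopologicalSpace Univ :=
  ⨆ V : Idx, TopologicalSpace.coinduced (Subtype.val : ↥V.1 → Univ) inferInstance

/-- Linear isometries `U^ι → U`, for `U = ℝ^∞` and a finite set `ι`. -/
abbrev Isom (ι : Type) [Fintype ι] : Type := PiLp 2 (fun _ : ι => Univ) →ₗᵢ[ℝ] Univ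

/-- The function space topology on linear isometries, where the target `U` has the topology of the
union of its finite dimensional subspaces. (By linearity, and since every compact subset of `U^ι`
lies in a finite dimensional subspace, the compact-open topology is that of pointwise
convergence.) -/
noncomputable instance (ι : Type) [Fintype ι] : TopologicalSpace (Isom ι) :=
  ⨅ x : PiLp 2 (fun _ : ι => Univ), TopologicalSpace.induced (fun g : Isom ι => g x) finTop

/-- `W = g (⨁ i, V i)`. -/
def Carries {ι : Type} [Fintype ι] (g : Isom ι) (V : ι → Idx) (W : Idx) : Prop :=
  ∀ x : Univ, x ∈ W.1 ↔ ∃ y : PiLp 2 (fun _ : ι => Univ), (∀ i, y i ∈ (V i).1) ∧ g y = x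

/-! ### Spectra

All spaces are compactly generated weak Hausdorff spaces. Accordingly, joint continuity of an
operation with several arguments (continuity for the compactly generated product) is expressed by
testing on compact Hausdorff spaces `K`. -/

/-- A coordinate-free `Ω`-spectrum indexed on the finite dimensional subspaces of `ℝ^∞`: based
spaces `E V` and structure maps `S^(W-V) ∧ E V → E W` whose adjoints `E V → Ω^(W-V) E W` are
homeomorphisms. -/
structure Spectrum where
  sp : Idx → Type u
  [top : ∀ V, TopologicalSpace (sp V)]
  /-- compactly generated -/
  cg : ∀ V, CompactlyGeneratedSpace (sp V)
  /-- weak Hausdorff: in a compactly generated space, this says that the diagonal is closed in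
  the compactly generated product -/
  wh : ∀ (V : Idx) (K : Type u) [TopologicalSpace K] [CompactSpace K] [T2Space K]
    (a b : C(K, sp V)), IsClosed {k | a k = b k}
  pt : ∀ V, sp V
  susp : ∀ {V W : Idx}, V ≤ W → Sphere V W → sp V → sp W
  susp_cont : ∀ {V W : Idx} (h : V ≤ W) (K : Type u) [TopologicalSpace K] [CompactSpace K]
    [T2Space K] (z : C(K, Sphere V W)) (a : C(K, sp V)), Continuous fun k => susp h (z k) (a k)
  susp_infty : ∀ {V W : Idx} (h : V ≤ W) (a : sp V), susp h OnePoint.infty a = pt W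
  susp_pt : ∀ {V W : Idx} (h : V ≤ W) (z : Sphere V W), susp h z (pt V) = pt W
  susp_refl : ∀ {V : Idx} (a : sp V), susp (le_refl V) ((0 : ↥(compl V V)) : Sphere V V) a = a
  susp_trans : ∀ {V W Z : Idx} (h : V ≤ W) (h' : W ≤ Z) (z : ↥(compl V W)) (z' : ↥(compl W Z))
    (z'' : ↥(compl V Z)), (z'' : Univ) = z + z' → ∀ a : sp V,
      susp h' (z' : Sphere W Z) (susp h (z : Sphere V W) a) =
        susp (h.trans h') (z'' : Sphere V Z) a
  /-- The adjoint structure map `E V → Ω^(W-V) E W` is a homeomorphism: for every compact Hausdorff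
  space `K`, maps `K → E V` correspond bijectively to based maps `S^(W-V) ∧ K₊ → E W`. -/
  loop : ∀ {V W : Idx} (h : V ≤ W) (K : Type u) [TopologicalSpace K] [CompactSpace K]
    [T2Space K] (f : C(K × Sphere V W, sp W)), (∀ k, f (k, OnePoint.infty) = pt W) →
      ∃! a : C(K, sp V), ∀ k z, susp h z (a k) = f (k, z)

attribute [instance] Spectrum.top

namespace Spectrum

/-- Maps of spectra. -/
@[ext]
structure Hom (E F : Spectrum.{u}) where
  app : ∀ V, C(E.sp V, F.sp V)
  app_pt : ∀ V, app V (E.pt V) = F.pt V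
  app_susp : ∀ {V W : Idx} (h : V ≤ W) (z : Sphere V W) (a : E.sp V),
    app W (E.susp h z a) = F.susp h z (app V a)

/-- Continuity of a family of points `y k ∈ N (W k)`, where the indexing space `W k` depends on
`k ∈ K`: for every `W'` containing all `W k`, the induced map to `N W'` from the Thom complex over
`K` of the bundle of the complements `W' - W k` is continuous. -/
def ContFamily (N : Spectrum.{u}) {K : Type u} [TopologicalSpace K] (W : K → Idx)
    (y : ∀ k, N.sp (W k)) : Prop :=
  ∀ (J : Type u) [TopologicalSpace J] [CompactSpace J] [T2Space J] (r : C(J, K))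
    (W' : Idx) (hW : ∀ j, W (r j) ≤ W') (t : C(J, OnePoint ↥W'.1))
    (z : ∀ j, Sphere (W (r j)) W'),
    (∀ j, (z j).map (Submodule.inclusion inf_le_right) = t j) →
      Continuous fun j => N.susp (hW j) (z j) (y (r j))

/-- A map of spectra `T ⋉ (⋀ i, E i) → N` from the twisted half-smash product of the external smash
product of the `E i` (indexed on `U^ι`) with a space `T` over the space of linear isometries
`U^ι → U`. It amounts to maps `⋀ i, E i (V i) → N (g_t (⨁ i, V i))` for `t ∈ T`, compatible with
suspensions and varying continuously with `t`. -/
structure TwistedMap {ι : Type} [Fintype ι] (T : Type w) [TopologicalSpace T] (g : T → Isom ι)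
    (E : ι → Spectrum.{u}) (N : Spectrum.{u}) where
  app : ∀ (t : T) (V : ι → Idx) (W : Idx), Carries (g t) V W → (∀ i, (E i).sp (V i)) → N.sp W
  app_pt : ∀ t V W h (a : ∀ i, (E i).sp (V i)), (∃ i, a i = (E i).pt (V i)) →
    app t V W h a = N.pt W
  app_susp : ∀ t V V' W W' (h : Carries (g t) V W) (h' : Carries (g t) V' W')
    (hV : ∀ i, V i ≤ V' i) (hW : W ≤ W') (z : ∀ i, ↥(compl (V i) (V' i))) (z' : ↥(compl W W')),
    (z' : Univ) = g t (WithLp.toLp 2 fun i => (z i : Univ)) → ∀ a : (∀ i, (E i).sp (V i)),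
      app t V' W' h' (fun i => (E i).susp (hV i) (z i : Sphere (V i) (V' i)) (a i)) =
        N.susp hW (z' : Sphere W W') (app t V W h a)
  cont : ∀ (K : Type u) [TopologicalSpace K] [CompactSpace K] [T2Space K] (t : C(K, T))
    (V : ι → Idx) (W : K → Idx) (h : ∀ k, Carries (g (t k)) V (W k))
    (a : ∀ i, C(K, (E i).sp (V i))),
    N.ContFamily W fun k => app (t k) V (W k) (h k) fun i => a i k

end Spectrum

/-! ### Operads over the linear isometries operad -/

/-- An operad augmented over the linear isometries operad. Operations are indexed by arbitrary
finite sets `ι` of inputs, functorially in bijections; the usual `n`-ary operations with their action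
of the symmetric group are those for `ι = Fin n`. -/
structure Operad where
  Op : (ι : Type) → [Fintype ι] → Type w
  [top : ∀ (ι : Type) [Fintype ι], TopologicalSpace (Op ι)]
  one : Op Unit
  reindex : ∀ {ι κ : Type} [Fintype ι] [Fintype κ], ι ≃ κ → Op ι → Op κ
  comp : ∀ {ι : Type} [Fintype ι] {κ : ι → Type} [∀ i, Fintype (κ i)],
    Op ι → (∀ i, Op (κ i)) → Op (Σ i, κ i)
  reindex_cont : ∀ {ι κ : Type} [Fintype ι] [Fintype κ] (e : ι ≃ κ),
    Continuous (reindex e : Op ι → Op κ)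
  comp_cont : ∀ {ι : Type} [Fintype ι] {κ : ι → Type} [∀ i, Fintype (κ i)]
    (K : Type w) [TopologicalSpace K] [CompactSpace K] [T2Space K]
    (c : C(K, Op ι)) (d : ∀ i, C(K, Op (κ i))), Continuous fun k => comp (c k) fun i => d i k
  reindex_refl : ∀ {ι : Type} [Fintype ι] (c : Op ι), reindex (Equiv.refl ι) c = c
  reindex_trans : ∀ {ι κ μ : Type} [Fintype ι] [Fintype κ] [Fintype μ] (e : ι ≃ κ) (e' : κ ≃ μ)
    (c : Op ι), reindex (e.trans e') c = reindex e' (reindex e c)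
  comp_reindex_left : ∀ {ι ι' : Type} [Fintype ι] [Fintype ι'] {κ : ι' → Type}
    [∀ i, Fintype (κ i)] (e : ι ≃ ι') (c : Op ι) (d : ∀ i, Op (κ i)),
    comp (reindex e c) d = reindex (Equiv.sigmaCongrLeft e) (comp c fun i => d (e i))
  comp_reindex_right : ∀ {ι : Type} [Fintype ι] {κ κ' : ι → Type} [∀ i, Fintype (κ i)]
    [∀ i, Fintype (κ' i)] (e : ∀ i, κ i ≃ κ' i) (c : Op ι) (d : ∀ i, Op (κ i)),
    comp c (fun i => reindex (e i) (d i)) = reindex (Equiv.sigmaCongrRight e) (comp c d)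
  one_comp : ∀ {κ : Type} [Fintype κ] (d : Op κ),
    reindex (Equiv.uniqueSigma fun _ : Unit => κ) (comp one fun _ => d) = d
  comp_one : ∀ {ι : Type} [Fintype ι] (c : Op ι),
    reindex (Equiv.sigmaUnique ι fun _ => Unit) (comp c fun _ => one) = c
  comp_assoc : ∀ {ι : Type} [Fintype ι] {κ : ι → Type} [∀ i, Fintype (κ i)]
    {μ : ∀ i, κ i → Type} [∀ i j, Fintype (μ i j)]
    (c : Op ι) (d : ∀ i, Op (κ i)) (f : ∀ i j, Op (μ i j)),
    reindex (Equiv.sigmaAssoc μ) (comp (comp c d) fun p => f p.1 p.2) =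
      comp c fun i => comp (d i) (f i)
  /-- there is exactly one nullary operation -/
  nullary : Op Empty
  eq_nullary : ∀ c : Op Empty, c = nullary
  /-- the augmentation to the linear isometries operad -/
  aug : ∀ {ι : Type} [Fintype ι], Op ι → Isom ι
  aug_cont : ∀ (ι : Type) [Fintype ι], Continuous (aug : Op ι → Isom ι)
  aug_one : ∀ x, aug one x = x ()
  aug_reindex : ∀ {ι κ : Type} [Fintype ι] [Fintype κ] (e : ι ≃ κ) (c : Op ι) x,
    aug (reindex e c) x = aug c (WithLp.toLp 2 fun i => x (e i))
  aug_comp : ∀ {ι : Type} [Fintype ι] {κ : ι → Type} [∀ i, Fintype (κ i)]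
    (c : Op ι) (d : ∀ i, Op (κ i)) x,
    aug (comp c d) x =
      aug c (WithLp.toLp 2 fun i => aug (d i) (WithLp.toLp 2 fun j => x ⟨i, j⟩))

attribute [instance] Operad.top

/-- `E_∞` operads: the spaces of operations are contractible, with free actions of the symmetric
groups. -/
structure Operad.IsEInfinity (𝒪 : Operad.{w}) : Prop where
  contractible : ∀ (ι : Type) [Fintype ι], ContractibleSpace (𝒪.Op ι)
  free : ∀ (ι : Type) [Fintype ι] (e : ι ≃ ι) (c : 𝒪.Op ι), 𝒪.reindex e c = c → e = Equiv.refl ι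

/-! ### Ring spectra over an operad -/

/-- A ring spectrum over the operad `𝒪`: a spectrum `E` with maps `𝒪(ι) ⋉ E^(∧ ι) → E` that are
unital, associative and equivariant. For an `E_∞` operad `𝒪`, this is an `E_∞` ring spectrum. -/
structure RingSpectrum (𝒪 : Operad.{w}) extends Spectrum.{u} where
  act : ∀ (ι : Type) [Fintype ι],
    Spectrum.TwistedMap (𝒪.Op ι) 𝒪.aug (fun _ => toSpectrum) toSpectrum
  act_one : ∀ (V : Idx) (h : Carries (𝒪.aug 𝒪.one) (fun _ => V) V) (a : sp V),
    (act Unit).app 𝒪.one (fun _ => V) V h (fun _ => a) = a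
  act_reindex : ∀ {ι κ : Type} [Fintype ι] [Fintype κ] (e : ι ≃ κ) (c : 𝒪.Op ι) (V : κ → Idx)
    (W : Idx) (h : Carries (𝒪.aug (𝒪.reindex e c)) V W)
    (h' : Carries (𝒪.aug c) (fun i => V (e i)) W) (a : ∀ j, sp (V j)),
    (act κ).app (𝒪.reindex e c) V W h a =
      (act ι).app c (fun i => V (e i)) W h' (fun i => a (e i))
  act_comp : ∀ {ι : Type} [Fintype ι] {κ : ι → Type} [∀ i, Fintype (κ i)]
    (c : 𝒪.Op ι) (d : ∀ i, 𝒪.Op (κ i)) (V : ∀ i, κ i → Idx) (W : ι → Idx) (Z : Idx)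
    (h : Carries (𝒪.aug (𝒪.comp c d)) (fun p => V p.1 p.2) Z) (hc : Carries (𝒪.aug c) W Z)
    (hd : ∀ i, Carries (𝒪.aug (d i)) (V i) (W i)) (a : ∀ i j, sp (V i j)),
    (act _).app (𝒪.comp c d) (fun p => V p.1 p.2) Z h (fun p => a p.1 p.2) =
      (act ι).app c W Z hc (fun i => (act (κ i)).app (d i) (V i) (W i) (hd i) (a i))

namespace RingSpectrum

variable {𝒪 : Operad.{w}}

/-- Maps of `𝒪`-ring spectra. -/
@[ext]
structure Hom (R S : RingSpectrum.{u, w} 𝒪) extends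
    Spectrum.Hom R.toSpectrum S.toSpectrum where
  app_act : ∀ {ι : Type} [Fintype ι] (c : 𝒪.Op ι) (V : ι → Idx) (W : Idx)
    (h : Carries (𝒪.aug c) V W) (a : ∀ i, R.sp (V i)),
    app W ((R.act ι).app c V W h a) = (S.act ι).app c V W h (fun i => app (V i) (a i))

instance : Category (RingSpectrum.{u, w} 𝒪) where
  Hom := Hom
  id R :=
    { app := fun V => ContinuousMap.id _
      app_pt := fun _ => rfl
      app_susp := fun _ _ _ => rfl
      app_act := fun _ _ _ _ _ => rfl }
  comp f g :=
    { app := fun V => (g.app V).comp (f.app V)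
      app_pt := fun V => by simp [f.app_pt, g.app_pt]
      app_susp := fun h z a => by simp [f.app_susp, g.app_susp]
      app_act := fun c V W h a => by simp [f.app_act, g.app_act] }

/-- The underlying maps of spaces of a map of ring spectra. -/
def map {R S : RingSpectrum.{u, w} 𝒪} (f : R ⟶ S) (V : Idx) : C(R.sp V, S.sp V) :=
  Spectrum.Hom.app (Hom.toHom f) V

/-- Weak equivalences of ring spectra are detected on spaces. -/
def IsWeakEquiv {R S : RingSpectrum.{u, w} 𝒪} (f : R ⟶ S) : Prop :=
  ∀ V, IsWeakHomotopyEquiv (map f V)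

@[ext]
theorem hom_ext {R S : RingSpectrum.{u, w} 𝒪} {f g : R ⟶ S}
    (h : ∀ V a, map f V a = map g V a) : f = g := by
  apply Hom.ext
  funext V
  exact ContinuousMap.ext (h V)

theorem map_id (R : RingSpectrum.{u, w} 𝒪) (V : Idx) (a : R.sp V) : map (𝟙 R) V a = a := rfl

theorem map_comp {R S T : RingSpectrum.{u, w} 𝒪} (f : R ⟶ S) (g : S ⟶ T) (V : Idx) (a : R.sp V) :
    map (f ≫ g) V a = map g V (map f V a) := rfl

end RingSpectrum

/-! ### Homotopy fixed points of spaces -/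

/-- `EG` is a model for the universal free `G`-space (for a finite group `G`): a contractible
compactly generated Hausdorff space with a free continuous `G`-action. -/
class IsUniversal (G : Type v) [Group G] (EG : Type u) [TopologicalSpace EG] [MulAction G EG] :
    Prop where
  t2 : T2Space EG
  cg : CompactlyGeneratedSpace EG
  contractible : ContractibleSpace EG
  continuous_smul : ∀ γ : G, Continuous fun e : EG => γ • e
  free : ∀ (γ : G) (e : EG), γ • e = e → γ = 1

/-- The homotopy fixed points `F(EG, X)^G` of a space `X` on which `γ ∈ G` acts by `ρ γ`. -/
def HFix {G : Type v} [Group G] (EG : Type u) [TopologicalSpace EG] [MulAction G EG] {X : Type u}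
    [TopologicalSpace X] (ρ : G → X → X) : Type u :=
  {f : C(EG, X) // ∀ γ e, f (γ • e) = ρ γ (f e)}

section HFix

variable {G : Type v} [Group G] {EG : Type u} [TopologicalSpace EG] [MulAction G EG] {X : Type u}
  [TopologicalSpace X] {ρ : G → X → X}

/-- The compactly generated topology associated with the compact-open topology. -/
instance : TopologicalSpace (HFix EG ρ) :=
  TopologicalSpace.compactlyGenerated.{u} {f : C(EG, X) // ∀ γ e, f (γ • e) = ρ γ (f e)}

theorem continuous_compactlyGenerated {K : Type u} [TopologicalSpace K] [CompactSpace K]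
    [T2Space K] {Y : Type u} [tY : TopologicalSpace Y] {f : K → Y} (hf : Continuous f) :
    @Continuous K Y _ (TopologicalSpace.compactlyGenerated.{u} Y) f := by
  rw [continuous_def]
  intro s hs
  exact (isOpen_sigma_iff.1 (isOpen_coinduced.1 hs)) ⟨CompHaus.of K, ⟨f, hf⟩⟩

theorem continuous_of_compactlyGenerated {Y : Type u} [tY : TopologicalSpace Y] :
    @Continuous Y Y (TopologicalSpace.compactlyGenerated.{u} Y) tY id :=
  continuous_from_compactlyGenerated _ fun _ g => g.continuous

theorem compactlyGeneratedSpace_compactlyGenerated (Y : Type u) [tY : TopologicalSpace Y] :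
    @UCompactlyGeneratedSpace.{u} Y (TopologicalSpace.compactlyGenerated.{u} Y) := by
  refine @uCompactlyGeneratedSpace_of_isOpen Y (TopologicalSpace.compactlyGenerated.{u} Y)
    fun s h => ?_
  refine isOpen_coinduced.2 (isOpen_sigma_iff.2 ?_)
  rintro ⟨K, g⟩
  exact h K (@ContinuousMap.mk K Y _ (TopologicalSpace.compactlyGenerated.{u} Y) g
    (continuous_compactlyGenerated g.continuous))

theorem HFix.continuous_val : Continuous fun f : HFix EG ρ => (f.1 : C(EG, X)) :=
  Continuous.comp (g := fun f : {f : C(EG, X) // ∀ γ e, f (γ • e) = ρ γ (f e)} => f.1)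
    continuous_subtype_val
    (continuous_of_compactlyGenerated (Y := {f : C(EG, X) // ∀ γ e, f (γ • e) = ρ γ (f e)}))

theorem HFix.continuous_of_val {K : Type u} [TopologicalSpace K] [CompactSpace K]
    [T2Space K] {φ : K → HFix EG ρ} (h : Continuous fun k => (φ k).1) : Continuous φ :=
  continuous_compactlyGenerated (Y := {f : C(EG, X) // ∀ γ e, f (γ • e) = ρ γ (f e)})
    (Continuous.subtype_mk h fun k => (φ k).2)

theorem HFix.continuous_of_test [IsUniversal G EG] {K : Type u} [TopologicalSpace K]
    [CompactSpace K] [T2Space K] {φ : K → HFix EG ρ}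
    (h : ∀ (L : Type u) [TopologicalSpace L] [CompactSpace L] [T2Space L] (l : C(L, EG)),
      Continuous fun p : K × L => (φ p.1).1 (l p.2)) : Continuous φ := by
  have := IsUniversal.t2 G (EG := EG)
  refine HFix.continuous_of_val ?_
  rw [continuous_iff_continuousAt]
  intro k
  rw [ContinuousAt, ContinuousMap.tendsto_compactOpen_iff_forall]
  intro C hC
  have := isCompact_iff_compactSpace.1 hC
  have hc := h C ⟨Subtype.val, continuous_subtype_val⟩
  exact (ContinuousMap.curry ⟨_, hc⟩).continuous.tendsto k

theorem HFix.continuous_eval {K L : Type u} [TopologicalSpace K] [TopologicalSpace L]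
    [CompactSpace L] [T2Space L] {φ : K → HFix EG ρ} (h : Continuous φ) (l : C(L, EG)) :
    Continuous fun p : K × L => (φ p.1).1 (l p.2) := by
  have h1 : Continuous fun k => (φ k).1 := HFix.continuous_val.comp h
  have h2 : Continuous fun k => ((φ k).1).comp l :=
    (ContinuousMap.continuous_precomp l).comp h1
  exact ContinuousEval.continuous_eval.comp (h2.prodMap continuous_id)

theorem HFix.continuous_evalConst (e : EG) : Continuous fun f : HFix EG ρ => f.1 e :=
  (ContinuousEvalConst.continuous_eval_const (F := C(EG, X)) e).comp HFix.continuous_val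

/-- Evaluation at a point of `EG`. -/
def HFix.eval (ρ : G → X → X) (e : EG) : C(HFix EG ρ, X) :=
  ⟨fun f => f.1 e, HFix.continuous_evalConst e⟩

theorem continuous_of_test [IsUniversal G EG] {f : EG → X}
    (h : ∀ (L : Type u) [TopologicalSpace L] [CompactSpace L] [T2Space L] (l : C(L, EG)),
      Continuous fun p => f (l p)) : Continuous f :=
  have := IsUniversal.cg G (EG := EG)
  continuous_from_uCompactlyGeneratedSpace f fun L l => h L l

end HFix

/-! ### Homotopy fixed points of ring spectra -/

namespace Spectrum

theorem ContFamily.continuous {N : Spectrum.{u}} {K : Type u} [TopologicalSpace K] [CompactSpace K]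
    [T2Space K] {W : Idx} {y : K → N.sp W} (h : N.ContFamily (fun _ => W) y) : Continuous y := by
  have := h K (ContinuousMap.id K) W (fun _ => le_refl W) (ContinuousMap.const K ((0 : ↥W.1)))
    (fun _ => ((0 : ↥(compl W W)) : Sphere W W)) (fun _ => by simp)
  simpa [N.susp_refl] using this

end Spectrum

namespace RingSpectrum

variable {𝒪 : Operad.{w}} {G : Type v} [Group G] (EG : Type u) [TopologicalSpace EG]
  [MulAction G EG] {R : RingSpectrum.{u, w} 𝒪} (ρ : G →* End R)

/-- The action of `G` on the space `R V`. -/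
def spAct (V : Idx) (γ : G) : R.sp V → R.sp V := map (ρ γ) V

theorem onePoint_t2 {E : Type} [NormedAddCommGroup E] [InnerProductSpace ℝ E] (S : Submodule ℝ E)
    [FiniteDimensional ℝ S] : T2Space (OnePoint S) := by
  have : ProperSpace S := FiniteDimensional.proper ℝ S
  infer_instance

theorem sphere_t2 (V W : Idx) : T2Space (Sphere V W) :=
  have := W.2
  have : FiniteDimensional ℝ ↥(compl V W) := Submodule.finiteDimensional_of_le inf_le_right
  onePoint_t2 (compl V W)

variable [IsUniversal G EG]

/-- The function spectrum `F(EG₊, R)^G`: the spectrum of homotopy fixed points of a spectrum `R`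
with `G`-action. -/
noncomputable def hfixSpectrum : Spectrum.{u} where
  sp V := HFix EG (spAct ρ V)
  cg V := compactlyGeneratedSpace_compactlyGenerated
    {f : C(EG, R.sp V) // ∀ γ e, f (γ • e) = spAct ρ V γ (f e)}
  wh V K _ _ _ a b := by
    have : {k | a k = b k} = ⋂ e : EG, {k | (a k).1 e = (b k).1 e} := by
      ext k
      simp only [Set.mem_ofPred_eq, Set.mem_iInter]
      exact ⟨fun h e => by rw [h], fun h => Subtype.ext (ContinuousMap.ext h)⟩
    rw [this]
    exact isClosed_iInter fun e =>
      R.wh V K ((HFix.eval (spAct ρ V) e).comp a) ((HFix.eval (spAct ρ V) e).comp b)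
  pt V := ⟨ContinuousMap.const _ (R.pt V), fun γ e => ((ρ γ : R ⟶ R).app_pt V).symm⟩
  susp h z a := ⟨⟨fun e => R.susp h z (a.1 e), continuous_of_test (G := G) fun L _ _ _ l =>
      R.susp_cont h L (ContinuousMap.const _ z) (a.1.comp l)⟩, fun γ e => by
      have := a.2 γ e
      simp only [ContinuousMap.coe_mk, this]
      exact ((ρ γ : R ⟶ R).app_susp h z (a.1 e)).symm⟩
  susp_cont h K _ _ _ z a := HFix.continuous_of_test fun L _ _ _ l =>
    R.susp_cont h (K × L) (z.comp ⟨_, continuous_fst⟩) ⟨_, HFix.continuous_eval a.continuous l⟩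
  susp_infty h a := Subtype.ext (ContinuousMap.ext fun e => R.susp_infty h _)
  susp_pt h z := Subtype.ext (ContinuousMap.ext fun e => R.susp_pt h z)
  susp_refl a := Subtype.ext (ContinuousMap.ext fun e => R.susp_refl _)
  susp_trans h h' z z' z'' hz a :=
    Subtype.ext (ContinuousMap.ext fun e => R.susp_trans h h' z z' z'' hz _)
  loop := by
    intro V W h K _ _ _ f hf
    -- on test spaces `L → EG`
    have key : ∀ (L : Type u) [TopologicalSpace L] [CompactSpace L] [T2Space L] (l : C(L, EG)),
        ∃ a : C(K × L, R.sp V), ∀ k x z, R.susp h z (a (k, x)) = (f (k, z)).1 (l x) := by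
      intro L _ _ _ l
      have c : Continuous fun p : (K × L) × Sphere V W => (f (p.1.1, p.2)).1 (l p.1.2) :=
        (HFix.continuous_eval f.continuous l).comp
          (by fun_prop : Continuous fun p : (K × L) × Sphere V W => ((p.1.1, p.2), p.1.2))
      obtain ⟨a, ha, -⟩ := R.loop h (K × L) ⟨_, c⟩ (fun p => by
        change (f (p.1, OnePoint.infty)).1 (l p.2) = _
        rw [hf]; rfl)
      exact ⟨a, fun k x z => ha (k, x) z⟩
    have inj : ∀ a b : R.sp V, (∀ z : Sphere V W, R.susp h z a = R.susp h z b) → a = b := by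
      intro a b hab
      obtain ⟨c, -, hc⟩ := R.loop h PUnit.{u+1} ⟨fun p => R.susp h p.2 a,
        by
          have := sphere_t2 V W
          have := R.susp_cont h (ULift.{u} (Sphere V W)) ⟨ULift.down, continuous_uliftDown⟩
            (ContinuousMap.const _ a)
          exact this.comp (continuous_uliftUp.comp continuous_snd)⟩
        (fun _ => R.susp_infty h a)
      have h1 := hc (ContinuousMap.const _ a) (fun _ _ => rfl)
      have h2 := hc (ContinuousMap.const _ b) (fun _ z => (hab z).symm)
      exact DFunLike.congr_fun (h1.trans h2.symm) PUnit.unit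
    have ex : ∀ k e, ∃ a : R.sp V, ∀ z, R.susp h z a = (f (k, z)).1 e := by
      intro k e
      obtain ⟨a, ha⟩ := key PUnit.{u+1} (ContinuousMap.const _ e)
      exact ⟨a (k, PUnit.unit), fun z => ha k _ z⟩
    choose α hα using ex
    have cα : ∀ (L : Type u) [TopologicalSpace L] [CompactSpace L] [T2Space L] (l : C(L, EG)),
        Continuous fun p : K × L => α p.1 (l p.2) := by
      intro L _ _ _ l
      obtain ⟨a, ha⟩ := key L l
      have : (fun p : K × L => α p.1 (l p.2)) = a := by
        funext p
        exact inj _ _ fun z => (hα _ _ z).trans (ha p.1 p.2 z).symm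
      rw [this]
      exact a.continuous
    have cα' : ∀ k, Continuous (α k) := fun k => continuous_of_test (G := G) fun L _ _ _ l =>
      (cα L l).comp (by fun_prop : Continuous fun x : L => (k, x))
    have eqv : ∀ k γ e, α k (γ • e) = spAct ρ V γ (α k e) := by
      intro k γ e
      refine inj _ _ fun z => ?_
      rw [hα, (f (k, z)).2 γ e, ← hα]
      exact (ρ γ : R ⟶ R).app_susp h z _
    refine ⟨⟨fun k => ⟨⟨α k, cα' k⟩, eqv k⟩, HFix.continuous_of_test fun L _ _ _ l => cα L l⟩,
      fun k z => Subtype.ext (ContinuousMap.ext fun e => hα k e z), ?_⟩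
    intro b hb
    refine ContinuousMap.ext fun k => Subtype.ext (ContinuousMap.ext fun e => inj _ _ fun z => ?_)
    exact (congrArg (fun y : HFix EG (spAct ρ W) => y.1 e) (hb k z)).trans (hα k e z).symm

/-- The ring spectrum `R^{hG} = F(EG₊, R)^G` of homotopy fixed points of an `𝒪`-ring spectrum `R` on
which the group `G` acts by maps of `𝒪`-ring spectra; the multiplicative structure is pointwise. -/
noncomputable def hfix : RingSpectrum.{u, w} 𝒪 where
  toSpectrum := hfixSpectrum EG ρ
  act ι _ :=
    { app := fun t V W h a => ⟨⟨fun e => (R.act ι).app t V W h fun i => (a i).1 e,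
          continuous_of_test (G := G) fun L _ _ _ l =>
            ((R.act ι).cont L (ContinuousMap.const _ t) V (fun _ => W) (fun _ => h)
              fun i => (a i).1.comp l).continuous⟩, fun γ e => by
          simp only [ContinuousMap.coe_mk]
          refine Eq.trans ?_ ((ρ γ : R ⟶ R).app_act t V W h _).symm
          congr 1
          funext i
          exact (a i).2 γ e⟩
      app_pt := fun t V W h a ⟨i, hi⟩ => Subtype.ext (ContinuousMap.ext fun e =>
        (R.act ι).app_pt t V W h _ ⟨i, by rw [hi]; rfl⟩)
      app_susp := fun t V V' W W' h h' hV hW z z' hz a =>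
        Subtype.ext (ContinuousMap.ext fun e =>
          (R.act ι).app_susp t V V' W W' h h' hV hW z z' hz fun i => (a i).1 e)
      cont := fun K _ _ _ t V W h a J _ _ _ r W' hW s z hz =>
        HFix.continuous_of_test fun L _ _ _ l =>
          (R.act ι).cont (J × L) ((t.comp r).comp ⟨_, continuous_fst⟩) V (fun p => W (r p.1))
            (fun p => h (r p.1))
            (fun i => ⟨_, HFix.continuous_eval ((a i).comp r).continuous l⟩)
            (J × L) (ContinuousMap.id _) W' (fun p => hW p.1) (s.comp ⟨_, continuous_fst⟩)
            (fun p => z p.1) (fun p => hz p.1) }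
  act_one V h a := Subtype.ext (ContinuousMap.ext fun e => R.act_one V h _)
  act_reindex e c V W h h' a :=
    Subtype.ext (ContinuousMap.ext fun x => R.act_reindex e c V W h h' fun j => (a j).1 x)
  act_comp c d V W Z h hc hd a :=
    Subtype.ext (ContinuousMap.ext fun x => R.act_comp c d V W Z h hc hd fun i j => (a i j).1 x)

/-- For an `𝒪`-algebra map `η : A → R` with `γ ∘ η = η` for all `γ ∈ G`, the natural map
`A → R^{hG}`, with constant functions as values. -/
noncomputable def toHFix {A : RingSpectrum.{u, w} 𝒪} (η : A ⟶ R) (hη : ∀ γ, η ≫ ρ γ = η) :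
    A ⟶ hfix EG ρ :=
  Hom.mk
    { app := fun V =>
        { toFun := fun a => ⟨ContinuousMap.const _ (map η V a), fun γ _ =>
            (congrArg (fun f : A ⟶ R => map f V a) (hη γ)).symm⟩
          continuous_toFun := by
            have := A.cg V
            refine continuous_from_uCompactlyGeneratedSpace _ fun K g => ?_
            exact HFix.continuous_of_test fun L _ _ _ l =>
              (map η V).continuous.comp (g.continuous.comp continuous_fst) }
      app_pt := fun V => Subtype.ext (ContinuousMap.ext fun _ => η.app_pt V)
      app_susp := fun h z a => Subtype.ext (ContinuousMap.ext fun _ => η.app_susp h z a) }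
    (fun c V W h a => Subtype.ext (ContinuousMap.ext fun _ => η.app_act c V W h a))

end RingSpectrum

/-! ### Units -/

namespace RingSpectrum

variable {𝒪 : Operad.{w}}

/-- The space `Ω^∞ R`, the zeroth space of the spectrum `R`. -/
abbrev omegaInfty (R : RingSpectrum.{u, w} 𝒪) : Type u := R.sp Idx.zero

theorem carries_zero {ι : Type} [Fintype ι] (g : Isom ι) :
    Carries g (fun _ => Idx.zero) Idx.zero := by
  intro x
  simp only [Idx.zero, Submodule.mem_bot]
  constructor
  · rintro rfl
    exact ⟨0, fun _ => rfl, g.map_zero⟩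
  · rintro ⟨y, hy, rfl⟩
    have : y = 0 := by
      ext1 i
      exact hy i
    rw [this, g.map_zero]

/-- The action of the operad on the zeroth space. -/
noncomputable def act₀ (R : RingSpectrum.{u, w} 𝒪) {ι : Type} [Fintype ι] (c : 𝒪.Op ι) (a : ι → R.omegaInfty) :
    R.omegaInfty :=
  (R.act ι).app c (fun _ => Idx.zero) Idx.zero (carries_zero _) a

/-- The product of two points of the zeroth space given by a binary operation `c`. -/
noncomputable def mul (R : RingSpectrum.{u, w} 𝒪) (c : 𝒪.Op (Fin 2)) (x y : R.omegaInfty) : R.omegaInfty :=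
  R.act₀ c ![x, y]

/-- The unit element of the zeroth space. -/
noncomputable def one (R : RingSpectrum.{u, w} 𝒪) : R.omegaInfty := R.act₀ 𝒪.nullary Empty.elim

/-- The class of `x` in `π₀ R = π₀ (Ω^∞ R)` is invertible for the product of `π₀ R`, which is
induced by any binary operation `c`. -/
noncomputable def IsPi0Unit (R : RingSpectrum.{u, w} 𝒪) (x : R.omegaInfty) : Prop :=
  ∀ c : 𝒪.Op (Fin 2), ∃ y, Joined (R.mul c x y) R.one ∧ Joined (R.mul c y x) R.one

/-- The units `GL₁ R`: the pullback of `Ω^∞ R → π₀ R ← (π₀ R)ˣ`. -/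
noncomputable def GL1 (R : RingSpectrum.{u, w} 𝒪) : Type u := {x : R.omegaInfty // R.IsPi0Unit x}

/-- The compactly generated topology associated with the subspace topology. -/
noncomputable instance (R : RingSpectrum.{u, w} 𝒪) : TopologicalSpace R.GL1 :=
  TopologicalSpace.compactlyGenerated.{u} {x : R.omegaInfty // R.IsPi0Unit x}

theorem map_act₀ {R S : RingSpectrum.{u, w} 𝒪} (f : R ⟶ S) {ι : Type} [Fintype ι] (c : 𝒪.Op ι)
    (a : ι → R.omegaInfty) :
    map f Idx.zero (R.act₀ c a) = S.act₀ c fun i => map f Idx.zero (a i) :=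
  Hom.app_act (show Hom R S from f) c _ _ _ _

theorem map_mul {R S : RingSpectrum.{u, w} 𝒪} (f : R ⟶ S) (c : 𝒪.Op (Fin 2))
    (x y : R.omegaInfty) :
    map f Idx.zero (R.mul c x y) = S.mul c (map f Idx.zero x) (map f Idx.zero y) := by
  rw [mul, mul, map_act₀]
  congr 1
  funext i
  fin_cases i <;> rfl

theorem map_one {R S : RingSpectrum.{u, w} 𝒪} (f : R ⟶ S) : map f Idx.zero R.one = S.one := by
  rw [one, one, map_act₀]
  congr 1
  funext i
  exact i.elim

theorem IsPi0Unit.map {R S : RingSpectrum.{u, w} 𝒪} (f : R ⟶ S) {x : R.omegaInfty}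
    (hx : R.IsPi0Unit x) : S.IsPi0Unit (map f Idx.zero x) := by
  intro c
  obtain ⟨y, ⟨p⟩, ⟨q⟩⟩ := hx c
  refine ⟨RingSpectrum.map f Idx.zero y, ?_, ?_⟩
  · rw [← map_mul, ← map_one f]
    exact ⟨p.map (RingSpectrum.map f Idx.zero).continuous⟩
  · rw [← map_mul, ← map_one f]
    exact ⟨q.map (RingSpectrum.map f Idx.zero).continuous⟩

/-- The action of `G` on `GL₁ R`, for a group `G` acting on `R` by maps of ring spectra. -/
noncomputable def glAct {G : Type v} [Group G] {R : RingSpectrum.{u, w} 𝒪} (ρ : G →* End R) (γ : G) :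
    R.GL1 → R.GL1 :=
  fun x => ⟨spAct ρ Idx.zero γ x.1, x.2.map (ρ γ)⟩

/-- The `G`-invariants of `π₀ R`. -/
def pi0Fixed {G : Type v} [Group G] {R : RingSpectrum.{u, w} 𝒪} (ρ : G →* End R) :
    Set (ZerothHomotopy R.omegaInfty) :=
  {a | ∀ γ, pi0Map (map (ρ γ) Idx.zero) a = a}

end RingSpectrum
end BraveNew

namespace BraveNew

/-! ### The linear isometries operad -/

/-- `ℝ^∞` is exhausted by the spans of the first `n` coordinate vectors. -/
theorem exists_exhaustion : ∃ F : ℕ → Idx, Monotone F ∧ ∀ V : Idx, ∃ n, V ≤ F n := by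
  let b : ℕ → Univ := fun i => ⟨lp.single 2 i (1 : ℝ), Submodule.subset_span ⟨i, rfl⟩⟩
  let F : ℕ → Submodule ℝ Univ := fun n => Submodule.span ℝ (b '' Set.Iio n)
  have mono : Monotone F := fun m n h =>
    Submodule.span_mono (Set.image_mono (Set.Iio_subset_Iio h))
  have ex : ∀ x : Univ, ∃ n, x ∈ F n := by
    rintro ⟨x, hx⟩
    induction hx using Submodule.span_induction with
    | mem x h =>
      obtain ⟨i, rfl⟩ := h
      exact ⟨i + 1, Submodule.subset_span ⟨i, by simp, rfl⟩⟩
    | zero => exact ⟨0, (F 0).zero_mem⟩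
    | add x y hx hy ihx ihy =>
      obtain ⟨m, hm⟩ := ihx
      obtain ⟨n, hn⟩ := ihy
      exact ⟨max m n, (F _).add_mem (mono (le_max_left m n) hm) (mono (le_max_right m n) hn)⟩
    | smul r x hx ih =>
      obtain ⟨m, hm⟩ := ih
      exact ⟨m, (F _).smul_mem r hm⟩
  refine ⟨fun n => ⟨F n, FiniteDimensional.span_of_finite ℝ ((Set.finite_Iio n).image b)⟩,
    fun m n h => mono h, ?_⟩
  rintro ⟨V, hV⟩
  obtain ⟨s, rfl⟩ := (Submodule.fg_iff_finiteDimensional V).2 hV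
  choose n hn using ex
  refine ⟨s.sup n, ?_⟩
  change Submodule.span ℝ _ ≤ F _
  rw [Submodule.span_le]
  exact fun x hx => mono (Finset.le_sup hx) (hn x)

theorem continuous_finTop_iff {K : Type} [TopologicalSpace K] [CompactSpace K] {f : K → Univ} :
    @Continuous K Univ _ finTop f ↔ (∃ V : Idx, ∀ k, f k ∈ V.1) ∧ Continuous f := by
  constructor
  · intro h
    have hle : finTop ≤ (inferInstance : TopologicalSpace Univ) :=
      iSup_le fun V => continuous_iff_coinduced_le.1 continuous_subtype_val
    refine ⟨?_, continuous_le_rng hle h⟩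
    by_contra hcon
    push Not at hcon
    obtain ⟨F, mono, ex⟩ := exists_exhaustion
    choose k hk using fun n => hcon (F n)
    let C : ℕ → Set Univ := fun m => {x | ∃ n, m ≤ n ∧ x = f (k n)}
    have hC : ∀ m, IsClosed[finTop] (C m) := by
      intro m
      rw [finTop, isClosed_iSup_iff]
      intro V
      rw [isClosed_coinduced]
      obtain ⟨j, hj⟩ := ex V
      have : ((Subtype.val : ↥V.1 → Univ) ⁻¹' C m).Finite := by
        refine Set.Finite.preimage Subtype.val_injective.injOn ?_ |>.subset
          (s := Subtype.val ⁻¹' ((fun n => f (k n)) '' Set.Iio j)) ?_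
        · exact (Set.finite_Iio j).image _
        · rintro ⟨x, hx⟩ ⟨n, -, rfl⟩
          refine ⟨n, ?_, rfl⟩
          by_contra hn
          exact hk n (mono (not_lt.1 hn) (hj hx))
      exact this.isClosed
    have hne : (⋂ m, f ⁻¹' C m).Nonempty := by
      refine IsCompact.nonempty_iInter_of_sequence_nonempty_isCompact_isClosed _ ?_ ?_ ?_ ?_
      · rintro m x ⟨n, hn, hx⟩
        exact ⟨n, (Nat.le_succ m).trans hn, hx⟩
      · exact fun m => ⟨k m, m, le_rfl, rfl⟩
      · exact (@IsClosed.preimage K Univ _ finTop f h _ (hC 0)).isCompact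
      · exact fun m => @IsClosed.preimage K Univ _ finTop f h _ (hC m)
    obtain ⟨x, hx⟩ := hne
    obtain ⟨m, hm⟩ := ex ⟨Submodule.span ℝ {f x}, inferInstance⟩
    obtain ⟨n, hn, hxn⟩ := Set.mem_iInter.1 hx m
    refine hk n (mono hn (hm ?_))
    rw [← hxn]
    exact Submodule.mem_span_singleton_self _
  · rintro ⟨⟨V, hV⟩, hf⟩
    have h1 : @Continuous ↥V.1 Univ _ finTop Subtype.val :=
      continuous_iff_coinduced_le.2
        (le_iSup (fun V : Idx => TopologicalSpace.coinduced (Subtype.val : ↥V.1 → Univ) _) V)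
    exact @Continuous.comp K ↥V.1 Univ _ _ finTop (fun k => ⟨f k, hV k⟩) Subtype.val h1
      (hf.subtype_mk hV)

theorem continuous_isom_iff {ι : Type} [Fintype ι] {K : Type} [TopologicalSpace K]
    {g : K → Isom ι} : Continuous g ↔ ∀ x, @Continuous K Univ _ finTop fun k => g k x := by
  rw [continuous_iInf_rng]
  exact forall_congr' fun x => continuous_induced_rng

theorem continuous_isom_eval {ι : Type} [Fintype ι] {K : Type} [TopologicalSpace K]
    [CompactSpace K] {g : K → Isom ι} (hg : Continuous g) {y : ι → K → Univ}
    (hy : ∀ i, @Continuous K Univ _ finTop (y i)) :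
    @Continuous K Univ _ finTop fun k => g k (WithLp.toLp 2 fun i => y i k) := by
  simp only [continuous_finTop_iff] at hy
  choose V hV using fun i => (hy i).1
  have hyc := fun i => (hy i).2
  classical
  let P : Submodule ℝ (PiLp 2 fun _ : ι => Univ) :=
    ⨆ i, (V i).1.map ((WithLp.linearEquiv 2 ℝ (ι → Univ)).symm.toLinearMap ∘ₗ
      LinearMap.single ℝ (fun _ : ι => Univ) i)
  have : ∀ i, FiniteDimensional ℝ (V i).1 := fun i => (V i).2
  have fdP : FiniteDimensional ℝ P := Submodule.finiteDimensional_iSup _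
  have hP : ∀ k, (WithLp.toLp 2 fun i => y i k : PiLp 2 fun _ : ι => Univ) ∈ P := by
    intro k
    have : (WithLp.toLp 2 fun i => y i k : PiLp 2 fun _ : ι => Univ) =
        ∑ i, ((WithLp.linearEquiv 2 ℝ (ι → Univ)).symm.toLinearMap ∘ₗ
          LinearMap.single ℝ (fun _ : ι => Univ) i) (y i k) := by
      simp only [LinearMap.comp_apply, LinearEquiv.coe_coe, ← map_sum]
      congr 1
      exact (LinearMap.sum_single_apply (fun _ : ι => Univ) fun i => y i k).symm
    rw [this]
    exact Submodule.sum_mem _ fun i _ =>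
      Submodule.mem_iSup_of_mem i ⟨_, hV i k, rfl⟩
  let u : K → P := fun k => ⟨_, hP k⟩
  have hu : Continuous u :=
    ((PiLp.continuous_toLp 2 _).comp (continuous_pi fun i => hyc i)).subtype_mk hP
  let B := Module.finBasis ℝ P
  have hg' := continuous_isom_iff.1 hg
  simp only [continuous_finTop_iff] at hg'
  have exp : ∀ k, g k (WithLp.toLp 2 fun i => y i k) =
      ∑ j, B.repr (u k) j • g k (B j : PiLp 2 fun _ : ι => Univ) := by
    intro k
    have h : ∀ p : P, g k p = ∑ j, B.repr p j • g k (B j : PiLp 2 fun _ : ι => Univ) := by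
      intro p
      conv_lhs => rw [← B.sum_repr p]
      rw [Submodule.coe_sum, map_sum]
      exact Finset.sum_congr rfl fun j _ => by rw [Submodule.coe_smul, map_smul]
    exact h (u k)
  choose Z hZ using fun x => (hg' x).1
  have hgc := fun x => (hg' x).2
  have : ∀ x, FiniteDimensional ℝ (Z x).1 := fun x => (Z x).2
  rw [continuous_finTop_iff]
  simp only [exp]
  refine ⟨⟨⟨⨆ j, (Z (B j : PiLp 2 fun _ : ι => Univ)).1,
    Submodule.finiteDimensional_iSup _⟩, fun k => ?_⟩, ?_⟩
  · exact Submodule.sum_mem _ fun j _ => Submodule.smul_mem _ _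
      (Submodule.mem_iSup_of_mem j (hZ _ k))
  · refine continuous_finsetSum _ fun j _ => ?_
    have h1 : Continuous fun k => B.repr (u k) j :=
      (LinearMap.continuous_of_finiteDimensional (B.coord j)).comp hu
    exact h1.smul (hgc _)

/-- Reindexing of linear isometries along a bijection. -/
noncomputable def Isom.reindex {ι κ : Type} [Fintype ι] [Fintype κ] (e : ι ≃ κ) (g : Isom ι) :
    Isom κ :=
  g.comp (LinearIsometryEquiv.piLpCongrLeft 2 ℝ Univ e.symm).toLinearIsometry

theorem Isom.reindex_apply {ι κ : Type} [Fintype ι] [Fintype κ] (e : ι ≃ κ) (g : Isom ι) (x) :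
    Isom.reindex e g x = g (WithLp.toLp 2 fun i => x (e i)) := by
  rfl

/-- The composition `g ∘ (⨁ i, d i)` of linear isometries. -/
noncomputable def Isom.multicomp {ι : Type} [Fintype ι] {κ : ι → Type} [∀ i, Fintype (κ i)]
    (g : Isom ι) (d : ∀ i, Isom (κ i)) : Isom (Σ i, κ i) where
  toFun x := g (WithLp.toLp 2 fun i => d i (WithLp.toLp 2 fun j => x ⟨i, j⟩))
  map_add' x y := by
    rw [← map_add]
    congr 1
    ext1 i
    exact map_add (d i) (WithLp.toLp 2 fun j => x ⟨i, j⟩) (WithLp.toLp 2 fun j => y ⟨i, j⟩)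
  map_smul' r x := by
    rw [RingHom.id_apply, ← map_smul]
    congr 1
    ext1 i
    exact map_smul (d i) r (WithLp.toLp 2 fun j => x ⟨i, j⟩)
  norm_map' x := by
    change ‖g _‖ = _
    rw [g.norm_map, PiLp.norm_eq_of_L2, PiLp.norm_eq_of_L2]
    congr 1
    rw [Fintype.sum_sigma]
    refine Finset.sum_congr rfl fun i _ => ?_
    change ‖d i _‖ ^ 2 = _
    rw [(d i).norm_map, PiLp.norm_sq_eq_of_L2]

/-- The linear isometries operad `ℒ`, with `ℒ(ι)` the space of linear isometries `U^ι → U`. -/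
noncomputable def linIsom : Operad.{0} where
  Op ι _ := Isom ι
  one :=
    { toFun := fun x => x ()
      map_add' := fun _ _ => rfl
      map_smul' := fun _ _ => rfl
      norm_map' := fun x => by
        rw [PiLp.norm_eq_of_L2, Fintype.sum_unique, Real.sqrt_sq (norm_nonneg _)]
        rfl }
  reindex e g := Isom.reindex e g
  comp c d := Isom.multicomp c d
  reindex_cont e := by
    refine continuous_iInf_rng.2 fun x => continuous_induced_rng.2 ?_
    exact continuous_iInf_dom (i := WithLp.toLp 2 fun i => x (e i)) continuous_induced_dom
  comp_cont K _ _ _ c d := by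
    refine continuous_isom_iff.2 fun x => ?_
    exact continuous_isom_eval c.continuous fun i => continuous_isom_iff.1 (d i).continuous _
  reindex_refl c := rfl
  reindex_trans e e' c := rfl
  comp_reindex_left e c d := by
    ext1 x
    rfl
  comp_reindex_right e c d := by
    ext1 x
    rfl
  one_comp d := by
    ext1 x
    rfl
  comp_one c := by
    ext1 x
    rfl
  comp_assoc c d f := by
    ext1 x
    rfl
  nullary :=
    { toFun := 0
      map_add' := by simp
      map_smul' := by simp
      norm_map' := fun x => by
        rw [Subsingleton.elim x 0]; simp }
  eq_nullary c := by
    ext1 x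
    rw [Subsingleton.elim x 0, map_zero, map_zero]
  aug g := g
  aug_cont _ _ := continuous_id
  aug_one x := rfl
  aug_reindex e c x := rfl
  aug_comp c d x := rfl

end BraveNew

namespace BraveNew

/-! ### Commutative `S`-algebras and weak Galois extensions

The `E_∞` ring spectra over the linear isometries operad `ℒ` are the commutative monoids in
`𝕃`-spectra for the smash product `∧_ℒ`; commutative `S`-algebras are those whose underlying
`𝕃`-spectrum is an `S`-module, i.e. for which `λ : S ∧_ℒ M → M` is an isomorphism. -/

/-- The restriction of `g : U ⊕ U → U` to the second summand. -/
noncomputable def Isom.second (g : Isom (Fin 2)) : Isom Unit where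
  toFun x := g (WithLp.toLp 2 ![0, x ()])
  map_add' x y := by
    rw [← map_add]
    congr 1
    ext1 i
    fin_cases i <;> simp
  map_smul' r x := by
    rw [RingHom.id_apply, ← map_smul]
    congr 1
    ext1 i
    fin_cases i <;> simp
  norm_map' x := by
    change ‖g _‖ = _
    rw [g.norm_map, PiLp.norm_eq_of_L2, PiLp.norm_eq_of_L2]
    simp

/-- `g' = g ∘ (f₁ ⊕ f₂)`. -/
def Isom.IsCompSum (g' g : Isom (Fin 2)) (f₁ f₂ : Isom Unit) : Prop :=
  ∀ x y : Univ, g' (WithLp.toLp 2 ![x, y]) =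
    g (WithLp.toLp 2 ![f₁ (WithLp.toLp 2 fun _ => x), f₂ (WithLp.toLp 2 fun _ => y)])

/-- A map of spectra `ℒ(2) ⋉ (S ∧ M) → N` (on the second summand `U` of `U ⊕ U`, these are the maps
`ℒ(2) ⋉ M → N` twisted by `g ↦ g|_{0 ⊕ U}`) coequalizes the right actions of `ℒ(1) × ℒ(1)` on
`ℒ(2)` and on `S ∧ M`, where `ℒ(1)` acts trivially on the sphere spectrum `S`. Such maps are the
maps of spectra `S ∧_ℒ M → N`. -/
def IsBalanced {M : RingSpectrum.{u, 0} linIsom} {N : Spectrum.{u}}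
    (θ : Spectrum.TwistedMap (Isom (Fin 2)) Isom.second (fun _ => M.toSpectrum) N) : Prop :=
  ∀ (g g' : Isom (Fin 2)) (f₁ f₂ : Isom Unit), g'.IsCompSum g f₁ f₂ →
    ∀ (V V' W : Idx) (h' : Carries g'.second (fun _ => V) W) (h : Carries g.second (fun _ => V') W)
      (hf : Carries f₂ (fun _ => V) V') (a : M.sp V),
      θ.app g' (fun _ => V) W h' (fun _ => a) =
        θ.app g (fun _ => V') W h (fun _ => (M.act Unit).app f₂ (fun _ => V) V' hf fun _ => a)

/-- The unit map `λ : S ∧_ℒ M → M`, `(g, s ∧ x) ↦ g|_{0 ⊕ U} · x`, is an isomorphism: every map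
`S ∧_ℒ M → N` factors uniquely through it. Together with the `E_∞` structure on `M`, this says that
`M` is a commutative `S`-algebra. -/
def IsCommSAlgebra : ObjectProperty (RingSpectrum.{u, 0} linIsom) := fun M =>
  ∀ (N : Spectrum.{u})
    (θ : Spectrum.TwistedMap (Isom (Fin 2)) Isom.second (fun _ => M.toSpectrum) N),
    IsBalanced θ → ∃! φ : Spectrum.Hom M.toSpectrum N,
      ∀ g V W h (a : M.sp V), θ.app g (fun _ => V) W h (fun _ => a) =
        φ.app W ((M.act Unit).app g.second (fun _ => V) W h fun _ => a)

/-- The category of commutative `S`-algebras. -/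
abbrev CommSAlg : Type (u + 1) := IsCommSAlgebra.{u}.FullSubcategory

/-- A map of `S`-modules `S ∧_ℒ 𝕃 (Σ^∞_V D₊) → X` from the free `S`-module on the shift
desuspension `Σ^∞_V D₊` of a space `D`. -/
structure FreeMap (X : RingSpectrum.{u, 0} linIsom) (V : Idx) (D : Type) [TopologicalSpace D] where
  app : ∀ (g : Isom (Fin 2)) (_ : D) (W : Idx), Carries g.second (fun _ => V) W → X.sp W
  app_right : ∀ (g g' : Isom (Fin 2)) (f₁ f₂ : Isom Unit), (∀ x, f₂ x = x ()) →
    g'.IsCompSum g f₁ f₂ → ∀ d W h h', app g' d W h' = app g d W h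
  app_left : ∀ (f : Isom Unit) (g g' : Isom (Fin 2)),
    (∀ x, g' x = f (WithLp.toLp 2 fun _ => g x)) →
    ∀ d W W' h h' (hf : Carries f (fun _ => W) W'),
      app g' d W' h' = (X.act Unit).app f (fun _ => W) W' hf fun _ => app g d W h
  cont : ∀ (K : Type u) [TopologicalSpace K] [CompactSpace K] [T2Space K]
    (g : C(K, Isom (Fin 2))) (d : C(K, D)) (W : K → Idx)
    (h : ∀ k, Carries (g k).second (fun _ => V) (W k)),
    X.ContFamily W fun k => app (g k) (d k) (W k) (h k)

/-- Acyclic fibrations of commutative `S`-algebras: the maps that have, as maps of `S`-modules, the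
right lifting property for the generating cofibrations, the inclusions of the free `S`-modules on
the pairs `(D^n, S^(n-1))`. -/
def IsAcyclicFibration {X Y : RingSpectrum.{u, 0} linIsom} (p : X ⟶ Y) : Prop :=
  ∀ (V : Idx) (n : ℕ) (a : FreeMap X V (Metric.sphere (0 : EuclideanSpace ℝ (Fin n)) 1))
    (b : FreeMap Y V (Metric.closedBall (0 : EuclideanSpace ℝ (Fin n)) 1)),
    (∀ g d W h, b.app g ⟨d.1, Metric.sphere_subset_closedBall d.2⟩ W h =
      RingSpectrum.map p W (a.app g d W h)) →
    ∃ l : FreeMap X V (Metric.closedBall (0 : EuclideanSpace ℝ (Fin n)) 1),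
      (∀ g d W h, l.app g ⟨d.1, Metric.sphere_subset_closedBall d.2⟩ W h = a.app g d W h) ∧
      ∀ g d W h, RingSpectrum.map p W (l.app g d W h) = b.app g d W h

/-- Let `A` be a commutative `S`-algebra and `B` a commutative `A`-algebra with unit map `η`, on
which the group `G` acts by maps `ρ γ`. Then `B` is a weak `G`-Galois extension of `A`. -/
structure IsWeakGalois {G : Type v} [Group G] (EG : Type u) [TopologicalSpace EG] [MulAction G EG]
    [IsUniversal G EG] {A B : CommSAlg.{u}} (η : A.obj ⟶ B.obj) (ρ : G →* End B.obj) : Prop where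
  /-- `G` acts by maps of `A`-algebras -/
  comm : ∀ γ, η ≫ ρ γ = η
  /-- `B` is a cofibrant commutative `A`-algebra -/
  cofibrant : ∀ {X Y : CommSAlg.{u}} (p : X ⟶ Y), IsAcyclicFibration p.hom →
    HasLiftingProperty (ObjectProperty.homMk η : A ⟶ B) p
  /-- `A → B^{hG}` is a weak equivalence -/
  unit : RingSpectrum.IsWeakEquiv (RingSpectrum.toHFix EG ρ η comm)
  /-- The map `Θ : B ∧_A B → F(G₊, B) = ∏_G B`, `b₁ ∧ b₂ ↦ (b₁ · γ b₂)_γ` is a weak equivalence.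
  Here `B ∧_A B` is the pushout of `B ← A → B` in commutative `S`-algebras, and `Θ` has components
  induced by the identity and `ρ γ`. -/
  theta : ∃ (P : CommSAlg.{u}) (i₁ i₂ : B ⟶ P)
    (sq : IsPushout (ObjectProperty.homMk η : A ⟶ B) (ObjectProperty.homMk η : A ⟶ B) i₁ i₂),
    ∀ V, IsWeakHomotopyEquiv (ContinuousMap.pi fun γ : G =>
      RingSpectrum.map (sq.desc (𝟙 B) (ObjectProperty.homMk (ρ γ) : B ⟶ B)
        (ObjectProperty.hom_ext _ (comm γ).symm)).hom V)

end BraveNew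

open BraveNew

namespace BraveNew

/-! ### Path components -/

/-! Both `GL₁(R)^{hG}` and `GL₁(R^{hG})` are unions of path components of `Ω^∞(R^{hG})`, with the
compactly generated topology. The former consists of the homotopy fixed points with all values
invertible, the latter of those invertible up to homotopy in `R^{hG}`. An inverse in `R^{hG}` can be
evaluated pointwise. Conversely, if `f(e₀)` has inverse `y`, then the class of `y` is `G`-invariant,
since inverses are unique and the class of `f(e₀)` is invariant. Surjectivity of `π₀(R^{hG}) →
π₀(R)^G` lifts it to some `g`, and injectivity turns `f(e₀)g(e₀) ≃ 1` into `fg ≃ 1`. So the two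
unions coincide (`range_hfixGLIncl`), and unions of the same components are homeomorphic
(`exists_homeomorph`).

For Hilbert 90, the weak equivalence `A → B^{hG}` is a bijection on `π₀`, so the assumption on
`π₀(A)` becomes the assumption on `π₀(B^{hG})` used above, and the map preserves and reflects units.
A weak equivalence restricts to one between corresponding unions of components
(`IsComponentInclusion.isWeakHomotopyEquiv`).

What enters about the operad is that any two operations with the same inputs are joined by a path;
this gives the unit and associativity laws on `π₀`. For `E_∞` operads this is contractibility. For
the linear isometries operad it is proved directly in `Isom.joined`. -/

theorem joined_iff_mk_eq {X : Type*} [TopologicalSpace X] {x y : X} :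
    Joined x y ↔ ZerothHomotopy.mk x = ZerothHomotopy.mk y :=
  ⟨fun ⟨p⟩ => ZerothHomotopy.sound p, fun h => Quotient.exact h⟩

theorem pi0Map_mk {X Y : Type*} [TopologicalSpace X] [TopologicalSpace Y] (f : C(X, Y)) (x : X) :
    pi0Map f (ZerothHomotopy.mk x) = ZerothHomotopy.mk (f x) := rfl

theorem joined_map {X Y : Type*} [TopologicalSpace X] [TopologicalSpace Y]
    (f : C(X, Y)) {x y : X} (h : Joined x y) : Joined (f x) (f y) :=
  ⟨h.somePath.map f.continuous⟩

namespace RingSpectrum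

variable {𝒪 : Operad.{w}} (R : RingSpectrum.{u, w} 𝒪)

/-! ### The multiplication on path components of the zeroth space -/

/-- Every isometry carries zero spaces to the zero space, so the target indexing space is constant
and `ContFamily` reduces to ordinary continuity. -/
theorem continuous_act₀ {ι : Type} [Fintype ι] {K : Type u} [TopologicalSpace K] [CompactSpace K]
    [T2Space K] (c : C(K, 𝒪.Op ι)) (a : ι → C(K, R.omegaInfty)) :
    Continuous fun k => R.act₀ (c k) fun i => a i k :=
  ((R.act ι).cont K c (fun _ => Idx.zero) (fun _ => Idx.zero) (fun _ => carries_zero _)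
    a).continuous

theorem joined_act₀ {ι : Type} [Fintype ι] {c c' : 𝒪.Op ι} (hc : Joined c c')
    {a a' : ι → R.omegaInfty} (ha : ∀ i, Joined (a i) (a' i)) :
    Joined (R.act₀ c a) (R.act₀ c' a') := by
  -- The operation and all arguments move simultaneously along their paths. Test spaces live in
  -- `Type u`, hence the lifted interval.
  have h := R.continuous_act₀ (K := ULift.{u} unitInterval)
    ⟨fun k => hc.somePath k.down, hc.somePath.continuous.comp continuous_uliftDown⟩
    fun i => ⟨fun k => (ha i).somePath k.down,
      (ha i).somePath.continuous.comp continuous_uliftDown⟩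
  exact ⟨⟨⟨_, h.comp continuous_uliftUp⟩, by simp, by simp⟩⟩

theorem act₀_reindex {ι κ : Type} [Fintype ι] [Fintype κ] (e : ι ≃ κ) (c : 𝒪.Op ι)
    (a : κ → R.omegaInfty) : R.act₀ (𝒪.reindex e c) a = R.act₀ c fun i => a (e i) :=
  R.act_reindex e c (fun _ => Idx.zero) Idx.zero _ _ a

theorem act₀_comp {ι : Type} [Fintype ι] {κ : ι → Type} [∀ i, Fintype (κ i)]
    (c : 𝒪.Op ι) (d : ∀ i, 𝒪.Op (κ i)) (a : (Σ i, κ i) → R.omegaInfty) :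
    R.act₀ (𝒪.comp c d) a = R.act₀ c fun i => R.act₀ (d i) fun j => a ⟨i, j⟩ :=
  R.act_comp c d (fun _ _ => Idx.zero) (fun _ => Idx.zero) Idx.zero _ _ (fun _ => carries_zero _)
    fun i j => a ⟨i, j⟩

theorem act₀_one (a : Unit → R.omegaInfty) : R.act₀ 𝒪.one a = a () :=
  R.act_one Idx.zero _ (a ())

theorem joined_mul {c : 𝒪.Op (Fin 2)} {x x' y y' : R.omegaInfty} (hx : Joined x x')
    (hy : Joined y y') : Joined (R.mul c x y) (R.mul c x' y') :=
  R.joined_act₀ (Joined.refl c) fun i => by fin_cases i <;> assumption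

/-! ### Composites of a binary operation with two operations -/

/-- The family of finite sets with `ι` over `0` and `κ` over `1`. -/
abbrev Arity (ι κ : Type) : Fin 2 → Type := ![ι, κ]

instance Arity.fintype (ι κ : Type) [Fintype ι] [Fintype κ] : ∀ i, Fintype (Arity ι κ i)
  | 0 => inferInstanceAs (Fintype ι)
  | 1 => inferInstanceAs (Fintype κ)

/-- A pair of operations, as a family over `Fin 2`. -/
def pairOp {ι κ : Type} [Fintype ι] [Fintype κ] (d : 𝒪.Op ι) (d' : 𝒪.Op κ) :
    ∀ i, 𝒪.Op (Arity ι κ i)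
  | 0 => d
  | 1 => d'

/-- The disjoint union of two finite sets, as a sum over `Fin 2`. -/
def arityEquiv (ι κ : Type) : ι ⊕ κ ≃ Σ i, Arity ι κ i where
  toFun := Sum.elim (fun i => ⟨0, i⟩) fun j => ⟨1, j⟩
  invFun
    | ⟨0, i⟩ => Sum.inl i
    | ⟨1, j⟩ => Sum.inr j
  left_inv x := by cases x <;> rfl
  right_inv
    | ⟨0, _⟩ => rfl
    | ⟨1, _⟩ => rfl

/-- The operation `c ∘ (d, d')`, with inputs indexed by the disjoint union. -/
def compPair {ι κ : Type} [Fintype ι] [Fintype κ] (c : 𝒪.Op (Fin 2)) (d : 𝒪.Op ι) (d' : 𝒪.Op κ) :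
    𝒪.Op (ι ⊕ κ) :=
  𝒪.reindex (arityEquiv ι κ).symm (𝒪.comp c (pairOp d d'))

/-- Indexing inputs by sums of types puts the two sides of each unit or associativity law over one
index set, up to a standard equivalence. They can then be compared as operations joined by a path.
-/
theorem act₀_compPair {ι κ : Type} [Fintype ι] [Fintype κ] (c : 𝒪.Op (Fin 2)) (d : 𝒪.Op ι)
    (d' : 𝒪.Op κ) (a : ι ⊕ κ → R.omegaInfty) :
    R.act₀ (compPair c d d') a =
      R.mul c (R.act₀ d fun i => a (Sum.inl i)) (R.act₀ d' fun j => a (Sum.inr j)) := by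
  rw [compPair, act₀_reindex, act₀_comp, mul]
  congr 1
  funext i
  fin_cases i <;> rfl

/-! ### Unit and associativity laws up to homotopy -/

/-- The composite `c ∘ (1, nullary)` and the reindexed identity both have inputs `Unit ⊕ Empty`;
they act by `x · 1` and by `x`. -/
theorem joined_mul_one (h𝒪 : ∀ (ι : Type) [Fintype ι] (c c' : 𝒪.Op ι), Joined c c')
    (c : 𝒪.Op (Fin 2)) (x : R.omegaInfty) : Joined (R.mul c x R.one) x := by
  have h := R.joined_act₀ (h𝒪 _ (compPair c 𝒪.one 𝒪.nullary)
    (𝒪.reindex (Equiv.sumEmpty Unit Empty).symm 𝒪.one)) (a := fun _ => x) (a' := fun _ => x)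
    fun _ => Joined.refl x
  rw [act₀_compPair, act₀_reindex, act₀_one] at h
  rwa [one, Subsingleton.elim (Empty.elim : Empty → R.omegaInfty) fun _ => x]

theorem joined_one_mul (h𝒪 : ∀ (ι : Type) [Fintype ι] (c c' : 𝒪.Op ι), Joined c c')
    (c : 𝒪.Op (Fin 2)) (x : R.omegaInfty) : Joined (R.mul c R.one x) x := by
  have h := R.joined_act₀ (h𝒪 _ (compPair c 𝒪.nullary 𝒪.one)
    (𝒪.reindex (Equiv.emptySum Empty Unit).symm 𝒪.one)) (a := fun _ => x) (a' := fun _ => x)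
    fun _ => Joined.refl x
  rw [act₀_compPair, act₀_reindex, act₀_one] at h
  rwa [one, Subsingleton.elim (Empty.elim : Empty → R.omegaInfty) fun _ => x]

theorem joined_mul_assoc (h𝒪 : ∀ (ι : Type) [Fintype ι] (c c' : 𝒪.Op ι), Joined c c')
    (c : 𝒪.Op (Fin 2)) (x y z : R.omegaInfty) :
    Joined (R.mul c (R.mul c x y) z) (R.mul c x (R.mul c y z)) := by
  -- `U` acts as `c`, but its inputs are indexed by `Unit ⊕ Unit`, so that both bracketings become
  -- operations over `Unit ⊕ (Unit ⊕ Unit)`.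
  let U := compPair c 𝒪.one 𝒪.one
  have hU : ∀ a : Unit ⊕ Unit → R.omegaInfty,
      R.act₀ U a = R.mul c (a (Sum.inl ())) (a (Sum.inr ())) := fun a => by
    rw [act₀_compPair, act₀_one, act₀_one]
  have h := R.joined_act₀ (h𝒪 _ (𝒪.reindex (Equiv.sumAssoc Unit Unit Unit) (compPair c U 𝒪.one))
    (compPair c 𝒪.one U)) (a := Sum.elim (fun _ => x) (Sum.elim (fun _ => y) fun _ => z))
    fun _ => Joined.refl _
  simp only [act₀_reindex, act₀_compPair, act₀_one, hU] at h
  exact h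

/-- Inverses are unique up to homotopy. -/
theorem joined_of_inverse (h𝒪 : ∀ (ι : Type) [Fintype ι] (c c' : 𝒪.Op ι), Joined c c')
    {c : 𝒪.Op (Fin 2)} {x y z : R.omegaInfty} (hy : Joined (R.mul c y x) R.one)
    (hz : Joined (R.mul c x z) R.one) : Joined y z :=
  -- The chain is `y ≃ y1 ≃ y(xz) ≃ (yx)z ≃ 1z ≃ z`.
  (R.joined_mul_one h𝒪 c y).symm.trans <|
    (R.joined_mul (Joined.refl y) hz.symm).trans <|
    (R.joined_mul_assoc h𝒪 c y x z).symm.trans <|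
    (R.joined_mul hy (Joined.refl z)).trans (R.joined_one_mul h𝒪 c z)

variable {R}

/-- Homotopic points have the same homotopy inverses, so the units form a union of path components.
-/
theorem IsPi0Unit.of_joined {x x' : R.omegaInfty} (hx : R.IsPi0Unit x) (h : Joined x x') :
    R.IsPi0Unit x' := fun c => by
  obtain ⟨y, h1, h2⟩ := hx c
  exact ⟨y, (R.joined_mul h.symm (Joined.refl y)).trans h1,
    (R.joined_mul (Joined.refl y) h.symm).trans h2⟩

/-! ### Units of the homotopy fixed points -/

variable {G : Type v} [Group G] {EG : Type u} [TopologicalSpace EG] [MulAction G EG]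
  [IsUniversal G EG] {ρ : G →* End R}

variable (ρ) in
/-- Evaluation at a point of `EG`, as a map `Ω^∞ (R^{hG}) → Ω^∞ R`. -/
noncomputable def hfixEval (e : EG) : C((hfix EG ρ).omegaInfty, R.omegaInfty) :=
  HFix.eval (spAct ρ Idx.zero) e

/-- The operations on `R^{hG}` are pointwise. Evaluation is only packaged as a continuous map here,
so its multiplicativity is checked directly and not through `map_mul`. -/
theorem hfix_mul_apply (c : 𝒪.Op (Fin 2)) (f g : (hfix EG ρ).omegaInfty) (e : EG) :
    hfixEval ρ e ((hfix EG ρ).mul c f g) =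
      R.mul c (hfixEval ρ e f) (hfixEval ρ e g) := by
  change R.act₀ c _ = R.act₀ c _
  congr 1
  funext i
  fin_cases i <;> rfl

theorem hfix_one_apply (e : EG) :
    hfixEval ρ e (hfix EG ρ).one = R.one := by
  change R.act₀ 𝒪.nullary _ = R.act₀ 𝒪.nullary _
  congr 1
  funext i
  exact i.elim

theorem IsPi0Unit.hfix_apply {f : (hfix EG ρ).omegaInfty} (hf : (hfix EG ρ).IsPi0Unit f) (e : EG) :
    R.IsPi0Unit (hfixEval ρ e f) := fun c => by
  obtain ⟨g, h1, h2⟩ := hf c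
  refine ⟨hfixEval ρ e g, ?_, ?_⟩
  · rw [← hfix_mul_apply, ← hfix_one_apply (ρ := ρ) e]
    exact joined_map _ h1
  · rw [← hfix_mul_apply, ← hfix_one_apply (ρ := ρ) e]
    exact joined_map _ h2

/-- If `π₀ (R^{hG}) → (π₀ R)^G` is bijective, a homotopy fixed point is a unit as soon as one of its
values is. -/
theorem IsPi0Unit.of_hfix_apply (h𝒪 : ∀ (ι : Type) [Fintype ι] (c c' : 𝒪.Op ι), Joined c c')
    {e₀ : EG} (h : Set.BijOn (pi0Map (hfixEval ρ e₀)) Set.univ (pi0Fixed ρ))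
    {f : (hfix EG ρ).omegaInfty} (hf : R.IsPi0Unit (hfixEval ρ e₀ f)) :
    (hfix EG ρ).IsPi0Unit f := fun c => by
  obtain ⟨y, h1, h2⟩ := hf c
  have hx : ∀ γ, Joined (RingSpectrum.map (ρ γ) Idx.zero (hfixEval ρ e₀ f))
      (hfixEval ρ e₀ f) := fun γ =>
    joined_iff_mk_eq.2 (h.mapsTo (Set.mem_univ (ZerothHomotopy.mk f)) γ)
  -- With `x = f(e₀)`, the point `γy` is a left inverse of `x`, because `γy · x ≃ γy · γx = γ(yx) ≃
  -- γ1 = 1`; and `y` is a right inverse.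
  have hy : ZerothHomotopy.mk y ∈ pi0Fixed ρ := fun γ => by
    rw [pi0Map_mk, ← joined_iff_mk_eq]
    refine R.joined_of_inverse h𝒪 (c := c) ?_ h1
    refine (R.joined_mul (Joined.refl _) (hx γ).symm).trans ?_
    rw [← map_mul, ← map_one (ρ γ)]
    exact joined_map _ h2
  -- Surjectivity supplies the candidate inverse `g`; injectivity, in the form `inj`, lets the two
  -- inverse relations be checked at `e₀`.
  obtain ⟨g, -, hg⟩ := h.surjOn hy
  obtain ⟨g, rfl⟩ := ZerothHomotopy.mk_surjective g
  rw [pi0Map_mk, ← joined_iff_mk_eq] at hg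
  have inj : ∀ {a b : (hfix EG ρ).omegaInfty}, Joined (hfixEval ρ e₀ a)
      (hfixEval ρ e₀ b) → Joined a b := fun hab =>
    joined_iff_mk_eq.2 (h.injOn (Set.mem_univ _) (Set.mem_univ _) (joined_iff_mk_eq.1 hab))
  refine ⟨g, inj ?_, inj ?_⟩
  · rw [hfix_mul_apply, hfix_one_apply]
    exact (R.joined_mul (Joined.refl _) hg).trans h1
  · rw [hfix_mul_apply, hfix_one_apply]
    exact (R.joined_mul hg (Joined.refl _)).trans h2

end RingSpectrum

/-! ### Inclusions of unions of path components -/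

/-- `i` identifies `X'` with a union of path components of `X`, up to the compactly generated
topology. -/
structure IsComponentInclusion {X' X : Type u} [TopologicalSpace X'] [TopologicalSpace X]
    (i : X' → X) : Prop where
  injective : Function.Injective i
  continuous : Continuous i
  lift : ∀ {K : Type u} [TopologicalSpace K] [CompactSpace K] [T2Space K] (φ : K → X'),
    Continuous (fun k => i (φ k)) → Continuous φ
  joined : ∀ {a : X'} {x : X}, Joined (i a) x → x ∈ Set.range i

namespace IsComponentInclusion

variable {X' X : Type u} [TopologicalSpace X'] [TopologicalSpace X] {i : X' → X}

/-- This is `lift` transported from `Type u` to `Type`, where intervals and cubes live. -/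
theorem exists_lift (hi : IsComponentInclusion i) {K : Type} [TopologicalSpace K] [CompactSpace K]
    [T2Space K] (f : C(K, X)) (hf : ∀ k, f k ∈ Set.range i) : ∃ g : C(K, X'), ∀ k, i (g k) = f k := by
  choose g hg using hf
  have h : Continuous fun k : ULift.{u} K => g k.down := by
    refine hi.lift _ ?_
    simp only [hg]
    exact f.continuous.comp continuous_uliftDown
  exact ⟨⟨g, h.comp continuous_uliftUp⟩, hg⟩

/-- A homotopy that starts in a union of path components stays in it. -/
theorem exists_lift_homotopy (hi : IsComponentInclusion i) {K : Type} [TopologicalSpace K]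
    [CompactSpace K] [T2Space K] {p q : C(K, X')} {S : Set K}
    (h : ContinuousMap.HomotopicRel ((⟨i, hi.continuous⟩ : C(X', X)).comp p)
      ((⟨i, hi.continuous⟩ : C(X', X)).comp q) S) : ContinuousMap.HomotopicRel p q S := by
  obtain ⟨H⟩ := h
  obtain ⟨L, hL⟩ := hi.exists_lift H.toContinuousMap fun k => by
    -- The track of the point `k.2`, rescaled to end at time `k.1`.
    refine hi.joined (a := p k.2) ⟨⟨⟨fun s => H (s * k.1, k.2), by fun_prop⟩, ?_, ?_⟩⟩
    · simp
    · simp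
  refine ⟨⟨⟨L, fun k => hi.injective ?_, fun k => hi.injective ?_⟩, fun t k hk => hi.injective ?_⟩⟩
  · exact (hL _).trans (H.apply_zero k)
  · exact (hL _).trans (H.apply_one k)
  · exact (hL _).trans (H.eq_fst t hk)

theorem joined_of_joined (hi : IsComponentInclusion i) {a b : X'} (h : Joined (i a) (i b)) :
    Joined a b := by
  obtain ⟨p⟩ := h
  obtain ⟨L, hL⟩ := hi.exists_lift p.toContinuousMap fun t =>
    -- The initial segment of `p` up to time `t` keeps `p t` in the component of `i a`.
    hi.joined (a := a) ⟨p.truncateOfLE t.2.1 |>.cast (by simp) (by simp)⟩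
  exact ⟨⟨L, hi.injective ((hL _).trans p.source), hi.injective ((hL _).trans p.target)⟩⟩

/-- Two unions of the same path components are homeomorphic. -/
theorem exists_homeomorph {X'' : Type u} [TopologicalSpace X''] {j : X'' → X}
    (hi : IsComponentInclusion i) (hj : IsComponentInclusion j)
    [UCompactlyGeneratedSpace.{u} X'] [UCompactlyGeneratedSpace.{u} X'']
    (h : Set.range i = Set.range j) : ∃ Φ : X' ≃ₜ X'', ∀ a, j (Φ a) = i a := by
  have h1 : ∀ a, ∃ b, j b = i a := fun a => h.subset (Set.mem_range_self a)
  have h2 : ∀ b, ∃ a, i a = j b := fun b => h.symm.subset (Set.mem_range_self b)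
  choose F hF using h1
  choose F' hF' using h2
  refine ⟨⟨⟨F, F', fun a => hi.injective ?_, fun b => hj.injective ?_⟩, ?_, ?_⟩, hF⟩
  · rw [hF', hF]
  · rw [hF, hF']
  -- Compact generation of the source reduces continuity to compact Hausdorff test spaces, where
  -- `lift` applies.
  · refine continuous_from_uCompactlyGeneratedSpace _ fun K g => hj.lift _ ?_
    simp only [Function.comp_apply, hF]
    exact hi.continuous.comp g.continuous
  · refine continuous_from_uCompactlyGeneratedSpace _ fun K g => hi.lift _ ?_
    simp only [Function.comp_apply, hF']
    exact hj.continuous.comp g.continuous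

variable {Y' Y : Type u} [TopologicalSpace Y'] [TopologicalSpace Y] {j : Y' → Y}

/-- A weak homotopy equivalence restricts to a weak homotopy equivalence between unions of path
components that correspond to each other. -/
theorem isWeakHomotopyEquiv (hi : IsComponentInclusion i) (hj : IsComponentInclusion j)
    {f : C(X, Y)} (hf : IsWeakHomotopyEquiv f) (g : C(X', Y')) (hg : ∀ a, j (g a) = f (i a))
    (reflect : ∀ x, f x ∈ Set.range j → x ∈ Set.range i) : IsWeakHomotopyEquiv g where
  pi0 := by
    constructor
    · intro a b hab
      obtain ⟨a, rfl⟩ := ZerothHomotopy.mk_surjective a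
      obtain ⟨b, rfl⟩ := ZerothHomotopy.mk_surjective b
      rw [pi0Map_mk, pi0Map_mk, ← joined_iff_mk_eq] at hab
      rw [← joined_iff_mk_eq]
      refine hi.joined_of_joined (joined_iff_mk_eq.2 (hf.pi0.1 ?_))
      rw [pi0Map_mk, pi0Map_mk, ← hg, ← hg, ← joined_iff_mk_eq]
      exact joined_map ⟨j, hj.continuous⟩ hab
    · intro b
      obtain ⟨b, rfl⟩ := ZerothHomotopy.mk_surjective b
      obtain ⟨x, hx⟩ := hf.pi0.2 (ZerothHomotopy.mk (j b))
      obtain ⟨x, rfl⟩ := ZerothHomotopy.mk_surjective x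
      rw [pi0Map_mk, ← joined_iff_mk_eq] at hx
      obtain ⟨a, rfl⟩ := reflect x (hj.joined hx.symm)
      refine ⟨ZerothHomotopy.mk a, ?_⟩
      rw [pi0Map_mk, ← joined_iff_mk_eq]
      refine hj.joined_of_joined ?_
      rwa [hg]
  pi n a := by
    constructor
    · rintro ⟨p⟩ ⟨q⟩ hpq
      have h : ContinuousMap.HomotopicRel (g.comp p.1) (g.comp q.1) (Cube.boundary (Fin n)) :=
        Quotient.exact hpq
      refine Quotient.sound (hi.exists_lift_homotopy ?_)
      -- The homotopy is pushed into `Y` along `j`, where `j ∘ g = f ∘ i`; injectivity of `f` on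
      -- `π_n` gives a homotopy in `X`, which lifts to `X'`.
      refine Quotient.exact ((hf.pi n (i a)).1
        (a₁ := Quotient.mk _ ⟨(⟨i, hi.continuous⟩ : C(X', X)).comp p.1, fun y hy =>
          congrArg i (p.2 y hy)⟩)
        (a₂ := Quotient.mk _ ⟨(⟨i, hi.continuous⟩ : C(X', X)).comp q.1, fun y hy =>
          congrArg i (q.2 y hy)⟩) (Quotient.sound ?_))
      have h' := h.map fun H => H.compContinuousMap (⟨j, hj.continuous⟩ : C(Y', Y))
      have e : ∀ r : C(Fin n → unitInterval, X'),
          (⟨j, hj.continuous⟩ : C(Y', Y)).comp (g.comp r) =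
            f.comp ((⟨i, hi.continuous⟩ : C(X', X)).comp r) :=
        fun r => ContinuousMap.ext fun y => hg (r y)
      rw [e, e] at h'
      exact h'
    · rintro ⟨q⟩
      obtain ⟨⟨p⟩, hp⟩ := (hf.pi n (i a)).2 (Quotient.mk _
        ⟨(⟨j, hj.continuous⟩ : C(Y', Y)).comp q.1, fun y hy =>
          (congrArg j (q.2 y hy)).trans (hg a)⟩)
      have h : ContinuousMap.HomotopicRel (f.comp p.1)
        ((⟨j, hj.continuous⟩ : C(Y', Y)).comp q.1) (Cube.boundary (Fin n)) := Quotient.exact hp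
      obtain ⟨H⟩ := h.symm
      -- For each `y`, the homotopy joins `j (q y)` to `f (p y)`. Hence `f (p y)` lies in the range
      -- of `j`, and `reflect` puts `p y` in the range of `i`.
      obtain ⟨p', hp'⟩ := hi.exists_lift p.1 fun y => reflect _ <| hj.joined (a := q.1 y)
        ⟨(H.toHomotopy.evalAt y)⟩
      refine ⟨Quotient.mk _ ⟨p', fun y hy => hi.injective ((hp' y).trans (p.2 y hy))⟩,
        Quotient.sound (hj.exists_lift_homotopy ?_)⟩
      have e : (⟨j, hj.continuous⟩ : C(Y', Y)).comp (g.comp p') = f.comp p.1 :=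
        ContinuousMap.ext fun y => (hg (p' y)).trans (congrArg f (hp' y))
      change ContinuousMap.HomotopicRel ((⟨j, hj.continuous⟩ : C(Y', Y)).comp (g.comp p')) _ _
      rw [e]
      exact h

end IsComponentInclusion

namespace RingSpectrum

variable {𝒪 : Operad.{w}} {R : RingSpectrum.{u, w} 𝒪}

/-! ### The space of units and its homotopy fixed points -/

/-- The inclusion `GL₁(R) → Ω^∞ R`. -/
noncomputable def glIncl (R : RingSpectrum.{u, w} 𝒪) (x : R.GL1) : R.omegaInfty := x.1

theorem isComponentInclusion_GL1 (R : RingSpectrum.{u, w} 𝒪) :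
    IsComponentInclusion R.glIncl where
  injective := Subtype.val_injective
  continuous := Continuous.comp (g := (Subtype.val : {x // R.IsPi0Unit x} → R.omegaInfty))
    continuous_subtype_val (continuous_of_compactlyGenerated (Y := {x // R.IsPi0Unit x}))
  lift φ h := continuous_compactlyGenerated (Y := {x // R.IsPi0Unit x})
    (Continuous.subtype_mk h fun k => (φ k).2)
  joined {a x} h := ⟨⟨x, a.2.of_joined h⟩, rfl⟩

variable {G : Type v} [Group G] {EG : Type u} [TopologicalSpace EG] [MulAction G EG]
  [IsUniversal G EG] (ρ : G →* End R)

/-- The inclusion `GL₁(R)^{hG} → Ω^∞ (R^{hG})`. -/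
noncomputable def hfixGLIncl (f : HFix EG (glAct ρ)) : (hfix EG ρ).omegaInfty :=
  ⟨⟨fun e => (f.1 e).1, R.isComponentInclusion_GL1.continuous.comp f.1.continuous⟩,
    fun γ e => congrArg Subtype.val (f.2 γ e)⟩

variable {ρ}

/-- A pointwise invertible homotopy fixed point lifts to the units. -/
theorem mem_range_hfixGLIncl {f : (hfix EG ρ).omegaInfty} :
    f ∈ Set.range (hfixGLIncl (EG := EG) ρ) ↔ ∀ e, R.IsPi0Unit (hfixEval ρ e f) := by
  constructor
  · rintro ⟨g, rfl⟩ e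
    exact (g.1 e).2
  · intro h
    refine ⟨⟨⟨fun e => ⟨hfixEval ρ e f, h e⟩, continuous_of_test (G := G) fun L _ _ _ l => ?_⟩,
      fun γ e => Subtype.ext (f.2 γ e)⟩, rfl⟩
    exact R.isComponentInclusion_GL1.lift (fun x : L => (⟨hfixEval ρ (l x) f, h (l x)⟩ : R.GL1))
      (f.1.continuous.comp l.continuous)

/-- Evaluation at each `e` is continuous, so pointwise invertibility is constant along paths. The
topological fields are checked on adjoint maps `K × L → X` for compact Hausdorff `L` over `EG`. -/
theorem isComponentInclusion_hfixGLIncl :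
    IsComponentInclusion (hfixGLIncl (EG := EG) ρ) where
  injective f g h := Subtype.ext (ContinuousMap.ext fun e =>
    Subtype.ext (congrArg (hfixEval ρ e) h))
  continuous := by
    have := compactlyGeneratedSpace_compactlyGenerated
      {f : C(EG, R.GL1) // ∀ γ e, f (γ • e) = glAct ρ γ (f e)}
    have : UCompactlyGeneratedSpace.{u} (HFix EG (glAct ρ)) := this
    refine continuous_from_uCompactlyGeneratedSpace _ fun K g => ?_
    exact HFix.continuous_of_test (ρ := spAct ρ Idx.zero) fun L _ _ _ l =>
      R.isComponentInclusion_GL1.continuous.comp (HFix.continuous_eval g.continuous l)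
  lift φ h := HFix.continuous_of_test fun L _ _ _ l =>
    R.isComponentInclusion_GL1.lift _ (HFix.continuous_eval (ρ := spAct ρ Idx.zero) h l)
  joined {a f} h := mem_range_hfixGLIncl.2 fun e => (a.1 e).2.of_joined (joined_map (hfixEval ρ e) h)

theorem uCompactlyGeneratedSpace_GL1 (R : RingSpectrum.{u, w} 𝒪) :
    UCompactlyGeneratedSpace.{u} R.GL1 :=
  compactlyGeneratedSpace_compactlyGenerated {x // R.IsPi0Unit x}

theorem uCompactlyGeneratedSpace_hfix (EG X : Type u) [TopologicalSpace EG] [MulAction G EG]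
    [TopologicalSpace X] (σ : G → X → X) : UCompactlyGeneratedSpace.{u} (HFix EG σ) :=
  compactlyGeneratedSpace_compactlyGenerated {f : C(EG, X) // ∀ γ e, f (γ • e) = σ γ (f e)}

/-- Invertibility at `e₀` alone gives invertibility in `R^{hG}`, which in turn gives invertibility
at every point. -/
theorem range_hfixGLIncl (h𝒪 : ∀ (ι : Type) [Fintype ι] (c c' : 𝒪.Op ι), Joined c c')
    {e₀ : EG} (h : Set.BijOn (pi0Map (hfixEval ρ e₀)) Set.univ (pi0Fixed ρ)) :
    Set.range (hfixGLIncl (EG := EG) ρ) =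
      Set.range (hfix EG ρ).glIncl := by
  ext f
  rw [mem_range_hfixGLIncl]
  exact ⟨fun hf => ⟨⟨f, .of_hfix_apply h𝒪 h (hf e₀)⟩, rfl⟩,
    fun ⟨g, hg⟩ e => hg ▸ g.2.hfix_apply e⟩

/-- `GL₁(R)^{hG} ≅ GL₁(R^{hG})`. -/
theorem exists_homeomorph_GL1_hfix
    (h𝒪 : ∀ (ι : Type) [Fintype ι] (c c' : 𝒪.Op ι), Joined c c')
    {e₀ : EG} (h : Set.BijOn (pi0Map (hfixEval ρ e₀)) Set.univ (pi0Fixed ρ)) :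
    ∃ Φ : HFix EG (glAct ρ) ≃ₜ (hfix EG ρ).GL1, ∀ f, (Φ f).1 = hfixGLIncl ρ f := by
  have := (hfix EG ρ).uCompactlyGeneratedSpace_GL1
  have := uCompactlyGeneratedSpace_hfix EG R.GL1 (glAct ρ)
  exact isComponentInclusion_hfixGLIncl.exists_homeomorph
    (hfix EG ρ).isComponentInclusion_GL1 (range_hfixGLIncl h𝒪 h)

/-- A map of ring spectra that is injective and surjective on `π₀` reflects units. -/
theorem IsPi0Unit.of_map {A S : RingSpectrum.{u, w} 𝒪} {f : A ⟶ S}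
    (hf : Function.Bijective (pi0Map (RingSpectrum.map f Idx.zero))) {x : A.omegaInfty}
    (hx : S.IsPi0Unit (RingSpectrum.map f Idx.zero x)) : A.IsPi0Unit x := fun c => by
  obtain ⟨y, h1, h2⟩ := hx c
  obtain ⟨z, hz⟩ := hf.2 (ZerothHomotopy.mk y)
  obtain ⟨z, rfl⟩ := ZerothHomotopy.mk_surjective z
  rw [pi0Map_mk, ← joined_iff_mk_eq] at hz
  have inj : ∀ {a b : A.omegaInfty}, Joined (RingSpectrum.map f Idx.zero a)
      (RingSpectrum.map f Idx.zero b) → Joined a b := fun hab =>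
    joined_iff_mk_eq.2 (hf.1 (joined_iff_mk_eq.1 hab))
  refine ⟨z, inj ?_, inj ?_⟩
  · rw [map_mul, map_one]
    exact (S.joined_mul (Joined.refl _) hz).trans h1
  · rw [map_mul, map_one]
    exact (S.joined_mul hz (Joined.refl _)).trans h2

/-- Topological Hilbert 90. -/
theorem exists_GL1_weakEquiv (h𝒪 : ∀ (ι : Type) [Fintype ι] (c c' : 𝒪.Op ι), Joined c c')
    (e₀ : EG) {A : RingSpectrum.{u, w} 𝒪} (η : A ⟶ R) (hη : ∀ γ, η ≫ ρ γ = η)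
    (hw : IsWeakEquiv (toHFix EG ρ η hη))
    (h : Set.BijOn (pi0Map (map η Idx.zero)) Set.univ (pi0Fixed ρ)) :
    ∃ j : C(A.GL1, HFix EG (glAct ρ)),
      (∀ (a : A.GL1) (e : EG), ((j a).1 e).1 = map η Idx.zero a.1) ∧ IsWeakHomotopyEquiv j := by
  let f := map (toHFix EG ρ η hη) Idx.zero
  have hf : IsWeakHomotopyEquiv f := hw Idx.zero
  have comp : ∀ a, pi0Map (hfixEval ρ e₀) (pi0Map f a) = pi0Map (map η Idx.zero) a := fun a => by
    obtain ⟨a, rfl⟩ := ZerothHomotopy.mk_surjective a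
    rfl
  -- In `π₀(A) → π₀(B^{hG}) → π₀(B)` the first map is bijective, so the bijectivity onto invariants
  -- passes from the composite to the evaluation.
  have hev : Set.BijOn (pi0Map (hfixEval ρ e₀)) Set.univ (pi0Fixed ρ) := by
    refine ⟨fun a _ => ?_, fun a _ b _ hab => ?_, fun b hb => ?_⟩
    · obtain ⟨a, rfl⟩ := hf.pi0.2 a
      rw [comp]
      exact h.mapsTo (Set.mem_univ a)
    · obtain ⟨a, rfl⟩ := hf.pi0.2 a
      obtain ⟨b, rfl⟩ := hf.pi0.2 b
      rw [comp, comp] at hab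
      rw [h.injOn (Set.mem_univ a) (Set.mem_univ b) hab]
    · obtain ⟨a, -, rfl⟩ := h.surjOn hb
      exact ⟨pi0Map f a, Set.mem_univ _, comp a⟩
  have hi := A.isComponentInclusion_GL1
  have hj := isComponentInclusion_hfixGLIncl (EG := EG) (ρ := ρ)
  have hrange := range_hfixGLIncl h𝒪 hev
  -- The values of `f` on units are units of `R^{hG}`, hence come from `GL₁(R)^{hG}` by `hrange`.
  have hex : ∀ a : A.GL1, ∃ b, hfixGLIncl (EG := EG) ρ b = f a.1 := fun a => by
    have : f a.1 ∈ Set.range (hfix EG ρ).glIncl :=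
      ⟨⟨_, a.2.map (toHFix EG ρ η hη)⟩, rfl⟩
    rwa [← hrange] at this
  choose j hj' using hex
  have hjc : Continuous j := by
    have := A.uCompactlyGeneratedSpace_GL1
    refine continuous_from_uCompactlyGeneratedSpace _ fun K g => hj.lift _ ?_
    simp only [Function.comp_apply, hj']
    exact f.continuous.comp (hi.continuous.comp g.continuous)
  refine ⟨⟨j, hjc⟩, fun a e => congrArg (hfixEval ρ e) (hj' a),
    hi.isWeakHomotopyEquiv hj hf ⟨j, hjc⟩ hj' fun x hx => ?_⟩
  rw [hrange] at hx
  obtain ⟨y, hy⟩ := hx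
  exact ⟨⟨x, .of_map hf.pi0 (hy ▸ y.2)⟩, rfl⟩

end RingSpectrum

/-! ### Path-connectedness of the spaces of linear isometries -/

theorem univ_inner_smul_left (r : ℝ) (x y : Univ) : inner ℝ (r • x) y = r * inner ℝ x y :=
  real_inner_smul_left x y r

theorem univ_inner_smul_right (r : ℝ) (x y : Univ) : inner ℝ x (r • y) = r * inner ℝ x y :=
  real_inner_smul_right x y r

/-- The standard orthonormal basis of `ℝ^∞`. -/
noncomputable def stdVec (i : ℕ) : Univ := ⟨lp.single 2 i (1 : ℝ), Submodule.subset_span ⟨i, rfl⟩⟩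

theorem orthonormal_stdVec : Orthonormal ℝ stdVec := by
  rw [orthonormal_iff_ite]
  intro i j
  change inner ℝ (lp.single 2 i (1 : ℝ) : lp (fun _ : ℕ => ℝ) 2) (lp.single 2 j (1 : ℝ)) = _
  rw [lp.inner_single_left, lp.single_apply]
  by_cases h : i = j
  · subst h
    simp
  · simp [h]

theorem span_stdVec : ⊤ ≤ Submodule.span ℝ (Set.range stdVec) := by
  rintro ⟨x, hx⟩ -
  induction hx using Submodule.span_induction with
  | mem x h =>
    obtain ⟨i, rfl⟩ := h
    exact Submodule.subset_span ⟨i, rfl⟩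
  | zero => exact Submodule.zero_mem _
  | add x y hx hy ihx ihy => exact Submodule.add_mem _ ihx ihy
  | smul r x hx ih => exact Submodule.smul_mem _ r ih

/-- The standard basis of `ℝ^∞`. -/
noncomputable def stdBasis : Module.Basis ℕ ℝ Univ :=
  Module.Basis.mk orthonormal_stdVec.linearIndependent span_stdVec

/-- The linear isometry with prescribed orthonormal values on the standard basis. -/
noncomputable def isomOfOrthonormal (v : ℕ → Univ) (hv : Orthonormal ℝ v) : Univ →ₗᵢ[ℝ] Univ :=
  (stdBasis.constr ℝ v).isometryOfOrthonormal (v := stdBasis)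
    (by simpa [stdBasis] using orthonormal_stdVec)
    (by
      have : stdBasis.constr ℝ v ∘ stdBasis = v := funext fun i => stdBasis.constr_basis ℝ v i
      rwa [this])

theorem isomOfOrthonormal_stdVec (v : ℕ → Univ) (hv : Orthonormal ℝ v) (i : ℕ) :
    isomOfOrthonormal v hv (stdVec i) = v i := by
  have : stdVec i = stdBasis i := by simp [stdBasis]
  rw [this]
  exact stdBasis.constr_basis ℝ v i

theorem univ_induction {p : Univ → Prop} (zero : p 0) (basis : ∀ i, p (stdVec i))
    (add : ∀ x y, p x → p y → p (x + y)) (smul : ∀ (r : ℝ) x, p x → p (r • x)) (x : Univ) : p x := by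
  have hx : x ∈ Submodule.span ℝ (Set.range stdVec) := span_stdVec trivial
  induction hx using Submodule.span_induction with
  | mem x h =>
    obtain ⟨i, rfl⟩ := h
    exact basis i
  | zero => exact zero
  | add x y _ _ hx hy => exact add x y hx hy
  | smul r x _ hx => exact smul r x hx

section

variable {K : Type} [TopologicalSpace K] [CompactSpace K]

/-- For compact `K`, continuity into `finTop` means ordinary continuity with values in one
finite-dimensional subspace. Constants, sums and scalar multiples are handled by exhibiting that
subspace. -/
theorem continuous_finTop_const (x : Univ) : @Continuous K Univ _ finTop fun _ => x :=
  continuous_finTop_iff.2 ⟨⟨⟨Submodule.span ℝ {x}, inferInstance⟩,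
    fun _ => Submodule.mem_span_singleton_self x⟩, continuous_const⟩

theorem continuous_finTop_add {f g : K → Univ} (hf : @Continuous K Univ _ finTop f)
    (hg : @Continuous K Univ _ finTop g) : @Continuous K Univ _ finTop fun k => f k + g k := by
  rw [continuous_finTop_iff] at *
  obtain ⟨⟨V, hV⟩, hf⟩ := hf
  obtain ⟨⟨W, hW⟩, hg⟩ := hg
  have := V.2
  have := W.2
  exact ⟨⟨⟨V.1 ⊔ W.1, inferInstance⟩, fun k =>
    Submodule.add_mem_sup (hV k) (hW k)⟩, hf.add hg⟩

theorem continuous_finTop_smul {c : K → ℝ} {f : K → Univ} (hc : Continuous c)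
    (hf : @Continuous K Univ _ finTop f) : @Continuous K Univ _ finTop fun k => c k • f k := by
  rw [continuous_finTop_iff] at *
  obtain ⟨⟨V, hV⟩, hf⟩ := hf
  exact ⟨⟨V, fun k => V.1.smul_mem _ (hV k)⟩, hc.smul hf⟩

end

/-! A homotopy through isometries from the identity to an isometry with large complement: the vector
`i` of the standard basis is rotated to the vector `2 i + 1` in the time from `1 / (i + 2)` to
`1 / (i + 1)`. -/

/-- The angle by which the vector `i` has been rotated at time `t`. -/
noncomputable def spreadAngle (t : ℝ) (i : ℕ) : ℝ :=
  -- Inside the truncation is the affine function of `t` with value `0` at `1 / (i + 2)` and `1` at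
  -- `1 / (i + 1)`.
  Real.pi / 2 * max 0 (min 1 ((i + 1) * ((i + 2) * t - 1)))

theorem spreadAngle_eq_zero {t : ℝ} {i : ℕ} (h : (i + 2) * t ≤ 1) : spreadAngle t i = 0 := by
  rw [spreadAngle, max_eq_left, mul_zero]
  refine (min_le_right _ _).trans (mul_nonpos_of_nonneg_of_nonpos (by positivity) (by linarith))

theorem spreadAngle_eq_pi_div_two {t : ℝ} {i : ℕ} (h : 1 ≤ (i + 1) * t) :
    spreadAngle t i = Real.pi / 2 := by
  have : (1 : ℝ) ≤ (i + 1) * ((i + 2) * t - 1) := by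
    have : (0 : ℝ) ≤ i := i.cast_nonneg
    nlinarith
  rw [spreadAngle, min_eq_left this, max_eq_right zero_le_one, mul_one]

/-- Larger indices turn earlier and the time intervals do not overlap: once `i` has started to turn,
every `j > i` has finished. -/
theorem sin_mul_cos_spreadAngle (t : ℝ) {i j : ℕ} (h : i < j) :
    Real.sin (spreadAngle t i) * Real.cos (spreadAngle t j) = 0 := by
  rcases le_total ((i + 2) * t) 1 with ht | ht
  · rw [spreadAngle_eq_zero ht, Real.sin_zero, zero_mul]
  · have hj : (i : ℝ) + 1 ≤ j := by exact_mod_cast h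
    have h0 : 0 ≤ t := by
      by_contra h0
      have : (0 : ℝ) ≤ i := i.cast_nonneg
      nlinarith
    rw [spreadAngle_eq_pi_div_two (i := j) (by nlinarith), Real.cos_pi_div_two, mul_zero]

/-- The image of the vector `i` at time `t`. -/
noncomputable def spreadVec (t : ℝ) (i : ℕ) : Univ :=
  Real.cos (spreadAngle t i) • stdVec i + Real.sin (spreadAngle t i) • stdVec (2 * i + 1)

theorem orthonormal_spreadVec (t : ℝ) : Orthonormal ℝ (spreadVec t) := by
  rw [orthonormal_iff_ite]
  have key : ∀ i j : ℕ, i < j → inner ℝ (spreadVec t i) (spreadVec t j) = (0 : ℝ) := by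
    intro i j hij
    simp only [spreadVec, inner_add_left, inner_add_right, univ_inner_smul_left,
      univ_inner_smul_right, orthonormal_iff_ite.1 orthonormal_stdVec]
    rw [if_neg (c := i = j) (by lia), if_neg (c := i = 2 * j + 1) (by lia),
      if_neg (c := 2 * i + 1 = 2 * j + 1) (by lia)]
    -- The one surviving cross term pairs the target of `i` with the source of `j`, when `j = 2 * i
    -- + 1`.
    linear_combination (if 2 * i + 1 = j then (1 : ℝ) else 0) * sin_mul_cos_spreadAngle t hij
  intro i j
  rcases lt_trichotomy i j with h | rfl | h
  · rw [if_neg h.ne, key i j h]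
  · simp only [spreadVec, inner_add_left, inner_add_right, univ_inner_smul_left,
      univ_inner_smul_right, orthonormal_iff_ite.1 orthonormal_stdVec]
    rw [if_pos trivial, if_neg (c := 2 * i + 1 = i) (by lia), if_neg (c := i = 2 * i + 1) (by lia)]
    linear_combination Real.sin_sq_add_cos_sq (spreadAngle t i)
  · rw [if_neg h.ne', real_inner_comm, key j i h]

/-- The isometry at time `t`. -/
noncomputable def spread (t : ℝ) : Univ →ₗᵢ[ℝ] Univ :=
  isomOfOrthonormal (spreadVec t) (orthonormal_spreadVec t)

theorem spread_stdVec (t : ℝ) (i : ℕ) : spread t (stdVec i) = spreadVec t i :=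
  isomOfOrthonormal_stdVec _ _ i

theorem spread_zero (x : Univ) : spread 0 x = x := by
  induction x using univ_induction with
  | zero => exact map_zero _
  | basis i => simp [spread_stdVec, spreadVec, spreadAngle_eq_zero]
  | add x y hx hy => rw [map_add, hx, hy]
  | smul r x hx => rw [map_smul, hx]

theorem spread_one_stdVec (i : ℕ) : spread 1 (stdVec i) = stdVec (2 * i + 1) := by
  rw [spread_stdVec, spreadVec, spreadAngle_eq_pi_div_two (by simp)]
  simp

/-- By linearity this is a statement about basis vectors, and each of these moves in a fixed plane.
-/
theorem continuous_spread (x : Univ) :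
    @Continuous unitInterval Univ _ finTop fun t => spread (t : ℝ) x := by
  induction x using univ_induction with
  | zero =>
    simp only [map_zero]
    exact continuous_finTop_const 0
  | basis i =>
    simp only [spread_stdVec, spreadVec]
    have : Continuous fun t : unitInterval => spreadAngle t i := by
      unfold spreadAngle
      fun_prop
    exact continuous_finTop_add
      (continuous_finTop_smul (Real.continuous_cos.comp this) (continuous_finTop_const _))
      (continuous_finTop_smul (Real.continuous_sin.comp this) (continuous_finTop_const _))
  | add x y hx hy =>
    simp only [map_add]
    exact continuous_finTop_add hx hy
  | smul r x hx =>
    simp only [map_smul]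
    exact continuous_finTop_smul continuous_const hx

/-- The isometry of `ℝ^∞` onto the span of the standard basis vectors of even index. -/
noncomputable def evenIsom : Univ →ₗᵢ[ℝ] Univ :=
  isomOfOrthonormal (fun i => stdVec (2 * i))
    (orthonormal_stdVec.comp _ fun i j h => by simpa using h)

/-- The two images are spanned by basis vectors of odd and of even index. -/
theorem inner_spread_one_evenIsom (x y : Univ) : inner ℝ (spread 1 x) (evenIsom y) = (0 : ℝ) := by
  induction x using univ_induction with
  | zero => rw [map_zero, inner_zero_left]
  | basis i =>
    induction y using univ_induction with
    | zero => rw [map_zero, inner_zero_right]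
    | basis j =>
      rw [spread_one_stdVec, evenIsom, isomOfOrthonormal_stdVec,
        orthonormal_iff_ite.1 orthonormal_stdVec, if_neg (by lia)]
    | add x y hx hy => rw [map_add, inner_add_right, hx, hy, add_zero]
    | smul r x hx => rw [map_smul, univ_inner_smul_right, hx, mul_zero]
  | add x y hx hy => rw [map_add, inner_add_left, hx, hy, add_zero]
  | smul r x hx => rw [map_smul, univ_inner_smul_left, hx, mul_zero]

/-! ### Joining arbitrary isometries -/

namespace Isom

variable {ι : Type} [Fintype ι]

theorem joined_spread_comp (g : Isom ι) : Joined g ((spread 1).comp g) :=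
  ⟨{ toFun := fun t => (spread (t : ℝ)).comp g
     continuous_toFun := continuous_isom_iff.2 fun x => continuous_spread (g x)
     source' := LinearIsometry.ext fun x => spread_zero (g x)
     target' := rfl }⟩

/-- Isometries with orthogonal images are joined by rotation. -/
theorem joined_of_inner_eq_zero {g h : Isom ι} (hgh : ∀ x y, inner ℝ (g x) (h y) = (0 : ℝ)) :
    Joined g h := by
  let r : unitInterval → Isom ι := fun t =>
    { toLinearMap := Real.cos (Real.pi / 2 * t) • g.toLinearMap +
        Real.sin (Real.pi / 2 * t) • h.toLinearMap
      norm_map' := fun x => by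
        change ‖Real.cos (Real.pi / 2 * t) • g x + Real.sin (Real.pi / 2 * t) • h x‖ = ‖x‖
        -- Orthogonality of the images removes the cross term of the squared norm.
        rw [← sq_eq_sq₀ (norm_nonneg _) (norm_nonneg _), norm_add_sq_real, univ_inner_smul_left,
          univ_inner_smul_right, hgh, norm_smul, norm_smul, mul_pow, mul_pow, g.norm_map,
          h.norm_map, Real.norm_eq_abs, Real.norm_eq_abs, sq_abs, sq_abs]
        linear_combination ‖x‖ ^ 2 * Real.sin_sq_add_cos_sq (Real.pi / 2 * t) }
  have hr : ∀ t x, r t x = Real.cos (Real.pi / 2 * t) • g x + Real.sin (Real.pi / 2 * t) • h x :=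
    fun _ _ => rfl
  refine ⟨⟨⟨r, continuous_isom_iff.2 fun x => ?_⟩, LinearIsometry.ext fun x => ?_,
    LinearIsometry.ext fun x => ?_⟩⟩
  · simp only [hr]
    exact continuous_finTop_add
      (continuous_finTop_smul (by fun_prop) (continuous_finTop_const _))
      (continuous_finTop_smul (by fun_prop) (continuous_finTop_const _))
  · change r 0 x = _
    simp [hr]
  · change r 1 x = _
    simp [hr]

/-- With `S = spread 1` and `E = evenIsom`, whose images are orthogonal, the chain is `g ≃ Sg ≃ Eg ≃
Sh ≃ h`. -/
theorem joined (g h : Isom ι) : Joined g h :=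
  (joined_spread_comp g).trans <|
    (joined_of_inner_eq_zero fun x y => inner_spread_one_evenIsom (g x) (g y)).trans <|
    (joined_of_inner_eq_zero (g := (spread 1).comp h) (h := evenIsom.comp g)
      fun x y => inner_spread_one_evenIsom (h x) (g y)).symm.trans (joined_spread_comp h).symm

end Isom

theorem Operad.IsEInfinity.joined {𝒪 : Operad.{w}} (h : 𝒪.IsEInfinity) (ι : Type) [Fintype ι]
    (c c' : 𝒪.Op ι) : Joined c c' :=
  have := h.contractible ι
  PathConnectedSpace.joined c c'

end BraveNew

/-! ### The main theorem -/

theorem mainTheorem10 {G : Type v} [Group G] [Finite G] (EG : Type u) [TopologicalSpace EG]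
    [MulAction G EG] [IsUniversal G EG] (e₀ : EG) :
    -- the homotopy fixed points of the units of an `E_∞` ring spectrum `R` with `G`-action
    (∀ (𝒪 : Operad.{w}), 𝒪.IsEInfinity → ∀ (R : RingSpectrum.{u, w} 𝒪) (ρ : G →* End R),
      Set.BijOn (pi0Map (HFix.eval (RingSpectrum.spAct ρ Idx.zero) e₀)) Set.univ
        (RingSpectrum.pi0Fixed ρ) →
      ∃ Φ : HFix EG (RingSpectrum.glAct ρ) ≃ₜ (RingSpectrum.hfix EG ρ).GL1,
        ∀ (f : HFix EG (RingSpectrum.glAct ρ)) (e : EG),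
          HFix.eval (RingSpectrum.spAct ρ Idx.zero) e (Φ f).1 = (f.1 e).1) ∧
    -- topological Hilbert 90, without any assumption on ramification
    (∀ (𝒪 : Operad.{w}), 𝒪.IsEInfinity → ∀ (A B : RingSpectrum.{u, w} 𝒪) (η : A ⟶ B)
      (ρ : G →* End B) (hη : ∀ γ, η ≫ ρ γ = η),
      RingSpectrum.IsWeakEquiv (RingSpectrum.toHFix EG ρ η hη) →
      Set.BijOn (pi0Map (RingSpectrum.map η Idx.zero)) Set.univ (RingSpectrum.pi0Fixed ρ) →
      ∃ j : C(A.GL1, HFix EG (RingSpectrum.glAct ρ)),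
        (∀ (a : A.GL1) (e : EG), ((j a).1 e).1 = RingSpectrum.map η Idx.zero a.1) ∧
          IsWeakHomotopyEquiv j) ∧
    -- topological Hilbert 90 for weak Galois extensions of commutative `S`-algebras
    (∀ (A B : CommSAlg.{u}) (η : A.obj ⟶ B.obj) (ρ : G →* End B.obj), IsWeakGalois EG η ρ →
      Set.BijOn (pi0Map (RingSpectrum.map η Idx.zero)) Set.univ (RingSpectrum.pi0Fixed ρ) →
      ∃ j : C(A.obj.GL1, HFix EG (RingSpectrum.glAct ρ)),
        (∀ (a : A.obj.GL1) (e : EG), ((j a).1 e).1 = RingSpectrum.map η Idx.zero a.1) ∧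
          IsWeakHomotopyEquiv j) := by
  refine ⟨fun 𝒪 h𝒪 R ρ h => ?_, fun 𝒪 h𝒪 A B η ρ hη hw h => ?_, fun A B η ρ hG h => ?_⟩
  · obtain ⟨Φ, hΦ⟩ := RingSpectrum.exists_homeomorph_GL1_hfix h𝒪.joined h
    exact ⟨Φ, fun f e => congrArg (RingSpectrum.hfixEval ρ e) (hΦ f)⟩
  · exact RingSpectrum.exists_GL1_weakEquiv h𝒪.joined e₀ η hη hw h
  -- A weak Galois extension is a case of the general statement over `linIsom`, where `Isom.joined`
  -- provides the paths between operations.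
  · exact RingSpectrum.exists_GL1_weakEquiv (𝒪 := linIsom) (fun _ _ => Isom.joined) e₀ η hG.comm
      hG.unit h
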